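/- Let $(\mathcal S,\mathcal A,r,P,\rho)$ be an MDP with finite state and action spaces, rewards $r\in[0,1]$ and initial state distribution $\rho$. Let $\Theta\subseteq\mathbb R^d$ be open and convex, and let $\{\pi_\theta\}_{\theta\in\Theta}$ be stationary policies with $\pi_\theta(a|s)>0$ and $\theta\mapsto\log\pi_\theta(a|s)$ differentiable. For a stationary policy $\pi$ let $d^{\pi}(s)=\lim_{T}\frac1T\sum_{t<T}\Pr(s_t=s\mid s_0\sim\rho,\pi)$, let $J^\pi=\lim_T\frac1T\mathbb E[\sum_{t<T}r(s_t,a_t)\mid s_0\sim\rho,\pi]$, and put $J(\theta)=J^{\pi_\theta}$, $J^*=\sup_{\theta\in\Theta}J(\theta)$. Assume: (i) for every $\theta\in\Theta$ the Markov chain with transition matrix $P^{\pi_\theta}(s,s')=\sum_aP(s'|s,a)\pi_\theta(a|s)$ has a single recurrent class $\mathcal S_R^\theta$ (transient states and periodicity are allowed); (ii) $\|\nabla_\theta\log\pi_\theta(a|s)\|\le G_1$ and $\|\nabla_\theta\log\pi_{\theta_1}(a|s)-\nabla_\theta\log\pi_{\theta_2}(a|s)\|\le G_2\|\theta_1-\theta_2\|$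 for all $\theta,\theta_1,\theta_2\in\Theta$, $s$, $a$; (iii) for some $\mu>0$ and all $\theta\in\Theta$, $F(\theta)-\mu I$ is positive semidefinite, where $F(\theta)=\sum_{s,a}d^{\pi_\theta}(s)\pi_\theta(a|s)\,\nabla_\theta\log\pi_\theta(a|s)\,\nabla_\theta\log\pi_\theta(a|s)^\top$; (iv) $J$ is differentiable on $\Theta$ with Lipschitz continuous gradient. Let $Q^{\pi_\theta}$ be a solution of the Bellman equation $Q(s,a)=r(s,a)-J(\theta)+\sum_{s'}P(s'|s,a)\sum_{a'}\pi_\theta(a'|s')Q(s',a')$ (unique up to an additive constant), $V^{\pi_\theta}(s)=\sum_a\pi_\theta(a|s)Q^{\pi_\theta}(s,a)$, $A^{\pi_\theta}(s,a)=Q^{\pi_\theta}(s,a)-V^{\pi_\theta}(s)$, and let $\omega_\theta^*=F(\theta)^{-1}\nabla J(\theta)$ be the exact natural policy gradient (NPG) direction. Let $\pi^*$ be an optimal policy: a stationary policy with $J^{\pi^*}\ge J(\theta)$ for all $\theta\in\Theta$. Put $$\epsilon_{\mathrm{bias}}=\sup_{\theta\in\Theta}\ \tfrac12\sum_{s,a}d^{\pi^*}(s)\pi^*(a|s)\big(A^{\pi_\theta}(s,a)-(\omega_\theta^*)^\top\nabla_\theta\log\pi_\theta(a|s)\big)^2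 .$$ Put $C=C_{\mathrm{hit}}+C_{\mathrm{tar}}$, where $C_{\mathrm{hit}}=\sup_{\theta\in\Theta}\max_{s}\mathbb E^\theta_s[T_{\mathcal S_R^\theta}]$ and $C_{\mathrm{tar}}=\sup_{\theta\in\Theta}\sum_{s'}d^{\pi_\theta}(s')\mathbb E^\theta_s[T_{s'}]$ for $s\in\mathcal S_R^\theta$ (the value does not depend on this $s$); here $T_D=\inf\{t\ge0:s_t\in D\}$, $T_{s'}=T_{\{s'\}}$. Natural Actor-Critic with Batching (NAC-B), with $K$ epochs, inner loop size $H$, batch size $B$, policy step size $\alpha>0$, critic step sizes $\beta,c_\beta\in\mathbb R$, NPG step size $\gamma\in\mathbb R$, critic features $\phi:\mathcal S\to\mathbb R^m$ and given initial parameters $\theta_0$, $\xi_0^k$, $\omega_0^k$, runs along a single trajectory of length $T=2KHB$ with $s_0\sim\rho$, $a_t\sim\pi_{\theta_k}(\cdot|s_t)$ for $t$ in epoch $k$ (that is, $2HBk\le t<2HB(k+1)$), $s_{t+1}\sim P(\cdot|s_t,a_t)$. The first $HB$ transitions of epoch $k$, in $H$ consecutive batches of $B$ transitions $z=(s,a,s')$,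 update the critic $\xi^k=(\eta,\zeta)\in\mathbb R\times\mathbb R^m$ by $\xi^k_{h+1}=\xi^k_h-\beta\cdot\frac1B\sum_z v(z;\xi^k_h)$ with $v(z;(\eta,\zeta))=\big(c_\beta(\eta-r(s,a)),\ [\eta+(\phi(s)-\phi(s'))^\top\zeta-r(s,a)]\phi(s)\big)$. With $\xi_k=\xi^k_H=(\eta_k,\zeta_k)$, the next $HB$ transitions update the NPG estimate by $\omega^k_{h+1}=\omega^k_h-\gamma\cdot\frac1B\sum_z\big[g^\top\omega^k_h-(r(s,a)-\eta_k+\zeta_k^\top(\phi(s')-\phi(s)))\big]g$, $g=\nabla_\theta\log\pi_{\theta_k}(a|s)$. With $\omega_k=\omega^k_H$, the policy update is $\theta_{k+1}=\theta_k+\alpha\omega_k$. Assume that $\theta_0,\dots,\theta_K\in\Theta$ almost surely. Write $\omega_k^*=\omega_{\theta_k}^*$, let $\mathbb E_k$ be the conditional expectation given the history up to the start of epoch $k$, and let $\mathrm{Reg}_T=\sum_{t=0}^{T-1}(J^*-r(s_t,a_t))$. Then $$\begin{aligned}\mathbb E[\mathrm{Reg}_T]\le{}& T\sqrt{2\epsilon_{\mathrm{bias}}}+2HBG_1\sum_{k=0}^{K-1}\mathbb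 E\big\|\mathbb E_k[\omega_k]-\omega_k^*\big\|+2\alpha G_2HB\sum_{k=0}^{K-1}\mathbb E\|\omega_k-\omega_k^*\|^2\\&+\frac{2\alpha G_2HB}{\mu^2}\sum_{k=0}^{K-1}\mathbb E\|\nabla_\theta J(\theta_k)\|^2+\frac{2HB}{\alpha}\,\mathbb E_{s\sim d^{\pi^*}}\big[\mathrm{KL}(\pi^*(\cdot|s)\,\|\,\pi_{\theta_0}(\cdot|s))\big]+2C(K+1).\end{aligned}$$ -/

import Mathlib

open MeasureTheory Filter Topology
open scoped ENNReal BigOperators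

noncomputable section

namespace NACB

/-! Finite average-reward Markov decision processes -/

/-- A finite MDP: reward `r`, transition function `P`, initial state distribution `ρ`. -/
structure MDP (S A : Type*) [Fintype S] where
  r : S → A → ℝ
  P : S → A → S → ℝ
  ρ : S → ℝ
  r_nonneg : ∀ s a, 0 ≤ r s a
  r_le_one : ∀ s a, r s a ≤ 1
  P_nonneg : ∀ s a s', 0 ≤ P s a s'
  P_sum : ∀ s a, ∑ s', P s a s' = 1
  ρ_nonneg : ∀ s, 0 ≤ ρ s
  ρ_sum : ∑ s, ρ s = 1

/-- `π s a` is the probability of action `a` in state `s`. -/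
def IsPolicy {S A : Type*} [Fintype A] (π : S → A → ℝ) : Prop :=
  (∀ s a, 0 ≤ π s a) ∧ ∀ s, ∑ a, π s a = 1

section Chain

variable {S A : Type*} [Fintype S] [DecidableEq S] [Fintype A]

/-- The state transition matrix induced by a policy. -/
def transition (M : MDP S A) (π : S → A → ℝ) : Matrix S S ℝ :=
  Matrix.of fun s s' => ∑ a, M.P s a s' * π s a

/-- `Pr(s_t = s | s_0 ∼ ρ, π)`. -/
def stateProb (M : MDP S A) (π : S → A → ℝ) (t : ℕ) (s : S) : ℝ :=
  Matrix.vecMul M.ρ (transition M π ^ t) s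

/-- The state distribution `d^π`: the Cesàro limit of the state probabilities from `ρ`
(for a finite chain this limit always exists). -/
def occupancy (M : MDP S A) (π : S → A → ℝ) (s : S) : ℝ :=
  limUnder atTop fun T : ℕ => (1 / (T : ℝ)) * ∑ t ∈ Finset.range T, stateProb M π t s

/-- The long-term average reward `J^π` from the initial distribution `ρ`
(for a finite chain this limit always exists). -/
def avgReward (M : MDP S A) (π : S → A → ℝ) : ℝ :=
  limUnder atTop fun T : ℕ =>
    (1 / (T : ℝ)) * ∑ t ∈ Finset.range T, ∑ s, ∑ a, stateProb M π t s * π s a * M.r s a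

/-- `s'` can be reached from `s` in some number of steps. -/
def Reaches (p : Matrix S S ℝ) (s s' : S) : Prop := ∃ n : ℕ, 0 < (p ^ n) s s'

/-- The recurrent states of a finite chain: those that can be reached again from every state
to which they lead. -/
def recurrentStates (p : Matrix S S ℝ) : Set S :=
  {s | ∀ s', Reaches p s s' → Reaches p s' s}

/-- The chain has a single recurrent class: any two recurrent states communicate
(a finite chain always has a recurrent state). Transient states and periodicity are allowed. -/
def IsUnichain (p : Matrix S S ℝ) : Prop :=
  ∀ s ∈ recurrentStates p, ∀ s' ∈ recurrentStates p, Reaches p s s'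

open Classical in
/-- `avoidProb p D t s = Pr(s_0 ∉ D, …, s_t ∉ D | s_0 = s)`, that is, the probability that the
first hitting time `inf {t ≥ 0 : s_t ∈ D}` of the set `D` exceeds `t`. -/
def avoidProb (p : Matrix S S ℝ) (D : Set S) : ℕ → S → ℝ
  | 0, s => if s ∈ D then 0 else 1
  | t + 1, s => if s ∈ D then 0 else ∑ s', p s s' * avoidProb p D t s'

/-- The expected first hitting time of `D` from `s`, as `∑_{t ≥ 0} Pr_s(hitting time > t)`. -/
def expectedHit (p : Matrix S S ℝ) (D : Set S) (s : S) : ℝ≥0∞ :=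
  ∑' t : ℕ, ENNReal.ofReal (avoidProb p D t s)

/-- `C_hit` of one policy: worst-case expected time to enter the recurrent class. -/
def cHit (M : MDP S A) (π : S → A → ℝ) : ℝ≥0∞ :=
  ⨆ s : S, expectedHit (transition M π) (recurrentStates (transition M π)) s

/-- `C_tar` of one policy: `∑_{s'} d^π(s') E_s[T_{s'}]` for a recurrent start `s`. The sum is the
same for all recurrent `s`, so that the supremum over such `s` only fixes a choice. -/
def cTar (M : MDP S A) (π : S → A → ℝ) : ℝ≥0∞ :=
  ⨆ s ∈ recurrentStates (transition M π),
    ∑ s', ENNReal.ofReal (occupancy M π s') * expectedHit (transition M π) {s'} s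

/-- The Bellman equation of the average-reward criterion. Under the unichain condition it has a
solution `Q`, unique up to an additive constant. -/
def IsBellman (M : MDP S A) (π : S → A → ℝ) (Q : S → A → ℝ) : Prop :=
  ∀ s a, Q s a = M.r s a - avgReward M π + ∑ s', M.P s a s' * ∑ a', π s' a' * Q s' a'

/-- A state-action value function: some solution of the Bellman equation. -/
def qValue (M : MDP S A) (π : S → A → ℝ) : S → A → ℝ :=
  Classical.epsilon (IsBellman M π)

def vValue (M : MDP S A) (π : S → A → ℝ) (s : S) : ℝ := ∑ a, π s a * qValue M π s a

/-- The advantage function; it does not depend on which solution `qValue` is. -/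
def advantage (M : MDP S A) (π : S → A → ℝ) (s : S) (a : A) : ℝ :=
  qValue M π s a - vValue M π s

/-- `E_{s ∼ d^{π₁}} KL(π₁(·|s) ‖ π₂(·|s))`. -/
def expectedKL (M : MDP S A) (π₁ π₂ : S → A → ℝ) : ℝ :=
  ∑ s, occupancy M π₁ s * ∑ a, π₁ s a * Real.log (π₁ s a / π₂ s a)

end Chain

/-! Parametrized policies -/

/-- Euclidean space of dimension `d`. -/
abbrev Vec (d : ℕ) := EuclideanSpace ℝ (Fin d)

/-- The score function `∇_θ log π_θ(a|s)`. -/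
def score {S A : Type*} {d : ℕ} (π : Vec d → S → A → ℝ) (θ : Vec d) (s : S) (a : A) : Vec d :=
  gradient (fun θ' => Real.log (π θ' s a)) θ

section Param

variable {S A : Type*} [Fintype S] [DecidableEq S] [Fintype A] {d : ℕ}

/-- `J(θ)`. -/
def objective (M : MDP S A) (π : Vec d → S → A → ℝ) (θ : Vec d) : ℝ := avgReward M (π θ)

/-- `J^* = sup_{θ ∈ Θ} J(θ)`. -/
def optValue (M : MDP S A) (π : Vec d → S → A → ℝ) (Θ : Set (Vec d)) : ℝ :=
  sSup (objective M π '' Θ)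

/-- The Fisher matrix `F(θ) = E_{ν^{π_θ}}[∇ log π_θ ⊗ ∇ log π_θ]`. -/
def fisher (M : MDP S A) (π : Vec d → S → A → ℝ) (θ : Vec d) : Matrix (Fin d) (Fin d) ℝ :=
  ∑ s, ∑ a, (occupancy M (π θ) s * π θ s a) •
    Matrix.vecMulVec (fun i => score π θ s a i) (fun i => score π θ s a i)

/-- The exact natural policy gradient direction `F(θ)⁻¹ ∇J(θ)`; where `F(θ)` is invertible
the pseudoinverse is the inverse. -/
def npgDir (M : MDP S A) (π : Vec d → S → A → ℝ) (θ : Vec d) : Vec d :=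
  WithLp.toLp 2 (Matrix.mulVec (fisher M π θ)⁻¹ fun i => gradient (objective M π) θ i)

/-- `L_{ν^{π'}}(ω, θ) = ½ E_{(s,a) ∼ ν^{π'}}[(A^{π_θ}(s,a) - ωᵀ∇ log π_θ(a|s))²]`, where
`ν^{π'}(s,a) = d^{π'}(s) π'(a|s)`. -/
def transferLoss (M : MDP S A) (π : Vec d → S → A → ℝ) (π' : S → A → ℝ) (w θ : Vec d) : ℝ :=
  (1 / 2) * ∑ s, ∑ a, occupancy M π' s * π' s a *
    (advantage M (π θ) s a - inner ℝ w (score π θ s a)) ^ 2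

/-- `ε_bias = sup_{θ ∈ Θ} L_{ν^{π^*}}(ω_θ^*, θ)`. -/
def epsBias (M : MDP S A) (π : Vec d → S → A → ℝ) (Θ : Set (Vec d)) (πstar : S → A → ℝ) : ℝ≥0∞ :=
  ⨆ θ ∈ Θ, ENNReal.ofReal (transferLoss M π πstar (npgDir M π θ) θ)

/-- `C = C_hit + C_tar = sup_θ C_hit^θ + sup_θ C_tar^θ`. -/
def cTotal (M : MDP S A) (π : Vec d → S → A → ℝ) (Θ : Set (Vec d)) : ℝ≥0∞ :=
  (⨆ θ ∈ Θ, cHit M (π θ)) + ⨆ θ ∈ Θ, cTar M (π θ)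

end Param

/-! Natural actor-critic with batching -/

/-- Inputs of the algorithm: step sizes, inner loop size `H`, batch size `B`, critic features
`φ`, and initial parameters. A critic parameter is a pair `(η, ζ)`. -/
structure Input (S : Type*) (d m : ℕ) where
  α : ℝ
  β : ℝ
  cβ : ℝ
  γ : ℝ
  H : ℕ
  B : ℕ
  φ : S → Vec m
  θ₀ : Vec d
  ω₀ : ℕ → Vec d
  ξ₀ : ℕ → ℝ × Vec m

section Algorithm

variable {S A : Type*} [Fintype S] {d m : ℕ}

/-- The critic update direction `A_v(z) ξ - b_v(z)` at the transition `z = (s, a, s')`. -/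
def criticDir (M : MDP S A) (I : Input S d m) (s : S) (a : A) (s' : S) (ξ : ℝ × Vec m) :
    ℝ × Vec m :=
  (I.cβ * ξ.1 - I.cβ * M.r s a,
    ξ.1 • I.φ s + inner ℝ (I.φ s - I.φ s') ξ.2 • I.φ s - M.r s a • I.φ s)

/-- The advantage estimate `r(s,a) - η + ζᵀ(φ(s') - φ(s))`. -/
def advEst (M : MDP S A) (I : Input S d m) (s : S) (a : A) (s' : S) (ξ : ℝ × Vec m) : ℝ :=
  M.r s a - ξ.1 + inner ℝ ξ.2 (I.φ s' - I.φ s)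

/-- The NPG update direction `A_u(z) ω - b_u(z)`. -/
def actorDir (M : MDP S A) (π : Vec d → S → A → ℝ) (I : Input S d m) (θ : Vec d)
    (s : S) (a : A) (s' : S) (ξ : ℝ × Vec m) (w : Vec d) : Vec d :=
  inner ℝ (score π θ s a) w • score π θ s a - advEst M I s a s' ξ • score π θ s a

/-- Critic iterates along the trajectory `(x, y)` of states and actions, in an epoch that starts
at time `t₀`, starting from `ξ`. Iteration `h` uses the `B` transitions from time `t₀ + hB` on. -/
def criticIter (M : MDP S A) (I : Input S d m) (x : ℕ → S) (y : ℕ → A) (t₀ : ℕ)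
    (ξ : ℝ × Vec m) : ℕ → ℝ × Vec m
  | 0 => ξ
  | h + 1 => criticIter M I x y t₀ ξ h - I.β • ((1 / (I.B : ℝ)) • ∑ b ∈ Finset.range I.B,
      criticDir M I (x (t₀ + h * I.B + b)) (y (t₀ + h * I.B + b)) (x (t₀ + h * I.B + b + 1))
        (criticIter M I x y t₀ ξ h))

/-- NPG iterates along the trajectory `(x, y)`, from time `t₀` on, starting from `w`, with the
critic estimate `ξ`: stochastic gradient descent with step size `γ`. -/
def actorIter (M : MDP S A) (π : Vec d → S → A → ℝ) (I : Input S d m) (x : ℕ → S) (y : ℕ → A)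
    (t₀ : ℕ) (θ : Vec d) (ξ : ℝ × Vec m) (w : Vec d) : ℕ → Vec d
  | 0 => w
  | h + 1 => actorIter M π I x y t₀ θ ξ w h - I.γ • ((1 / (I.B : ℝ)) • ∑ b ∈ Finset.range I.B,
      actorDir M π I θ (x (t₀ + h * I.B + b)) (y (t₀ + h * I.B + b)) (x (t₀ + h * I.B + b + 1)) ξ
        (actorIter M π I x y t₀ θ ξ w h))

/-- The NPG estimate `ω_k` of epoch `k` when the policy parameter is `θ`: epoch `k` starts at time
`k · 2HB`; its first `HB` transitions feed the critic, the next `HB` the NPG estimate. -/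
def epochNPG (M : MDP S A) (π : Vec d → S → A → ℝ) (I : Input S d m) (x : ℕ → S) (y : ℕ → A)
    (k : ℕ) (θ : Vec d) : Vec d :=
  actorIter M π I x y (k * (2 * I.H * I.B) + I.H * I.B) θ
    (criticIter M I x y (k * (2 * I.H * I.B)) (I.ξ₀ k) I.H) (I.ω₀ k) I.H

/-- The policy parameters `θ_{k+1} = θ_k + α ω_k` along the trajectory `(x, y)`. -/
def policyParam (M : MDP S A) (π : Vec d → S → A → ℝ) (I : Input S d m) (x : ℕ → S) (y : ℕ → A) :
    ℕ → Vec d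
  | 0 => I.θ₀
  | k + 1 => policyParam M π I x y k +
      I.α • epochNPG M π I x y k (policyParam M π I x y k)

/-- The NPG estimates `ω_k` along the trajectory `(x, y)`. -/
def npgEst (M : MDP S A) (π : Vec d → S → A → ℝ) (I : Input S d m) (x : ℕ → S) (y : ℕ → A)
    (k : ℕ) : Vec d :=
  epochNPG M π I x y k (policyParam M π I x y k)

/-- The processes `s`, `a` are a run of the algorithm for `K` epochs on the MDP, as a single
trajectory of length `2KHB`: `s_0 ∼ ρ`, `a_t ∼ π_{θ_k}(·|s_t)` for `t` in epoch `k = ⌊t/(2HB)⌋`,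
and `s_{t+1} ∼ P(·|s_t, a_t)`. -/
structure IsRun (M : MDP S A) (π : Vec d → S → A → ℝ) (I : Input S d m) (K : ℕ)
    {Ω : Type*} [MeasurableSpace Ω] (Pr : Measure Ω) (s : ℕ → Ω → S) (a : ℕ → Ω → A) : Prop where
  meas_state : ∀ t x, MeasurableSet (s t ⁻¹' {x})
  meas_action : ∀ t y, MeasurableSet (a t ⁻¹' {y})
  law : ∀ n ≤ K * (2 * I.H * I.B), ∀ (x : ℕ → S) (y : ℕ → A),
    Pr.real {o | (∀ t ≤ n, s t o = x t) ∧ ∀ t < n, a t o = y t} =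
      M.ρ (x 0) * ∏ t ∈ Finset.range n,
        (π (policyParam M π I x y (t / (2 * I.H * I.B))) (x t) (y t) * M.P (x t) (y t) (x (t + 1)))

/-- The history up to time `n`: generated by `s_0, a_0, …, s_{n-1}, a_{n-1}, s_n`. -/
abbrev history {Ω : Type*} (s : ℕ → Ω → S) (a : ℕ → Ω → A) (n : ℕ) : MeasurableSpace Ω :=
  (⨆ t ∈ Set.Iic n, MeasurableSpace.comap (s t) ⊤) ⊔
    ⨆ t ∈ Set.Iio n, MeasurableSpace.comap (a t) ⊤

end Algorithm

end NACB

end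

open NACB

/-! In epoch `k`, write `J* - r` as `(J* - J(θ_k)) + (J(θ_k) - r)`; the two parts have separate
causes.

The second part is the cost of running a chain from a non-stationary state. The value function
solves the Poisson equation `V = (r_π - J) + P_π V`, and the policy is frozen during the epoch, so
the expected sum telescopes to the expected value at the end minus that at the start. It is
therefore at most the span of `V`. Since the source is bounded by one, `V` varies by at most the
expected time needed to reach a set: entering the recurrent class costs `C_hit`, and then meeting a
target drawn from `d^π` costs `C_tar`. So `V` stays within `C` of its `d^π`-mean, and each epoch
costs at most `2C` (`vValue_sub_le`, `IsRun.integral_epoch_le`).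

The first part is policy optimization (`suboptimality_le`). By `performance_difference`, the gap to
`π*` is the average advantage under the state-action distribution of `π*`. Replacing the advantage
by its linear model with direction `ω*` costs `√(2 ε_bias)` by Cauchy-Schwarz. What remains is `⟨u,
ω*⟩ = ⟨u, ω* - ω⟩ + ⟨u, ω⟩` with `u` the mean score. The descent lemma for `log π_θ` bounds `α⟨u,
ω⟩` by the decrease of the expected KL divergence to `π*`, plus a quadratic term in `ω`; the
decreases telescope over epochs. The quadratic term is controlled by `‖ω - ω*‖` and by `‖ω*‖ ≤ ‖∇J‖
/ μ`. As `u` and `ω*` are known when the epoch starts, `ω` in `⟨u, ω* - ω⟩` may be replaced by its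
conditional mean, so that only the bias of the estimate enters at first order.

Finiteness of `S` and `A` provides the rest: Cesàro limits exist by the splitting `ker (1 - A) ⊕
range (1 - A)`, and every quantity attached to an epoch factors through a finite path prefix, hence
is measurable and integrable whatever its regularity. -/

noncomputable section

namespace NACB

/-! ### Mean ergodic decomposition of power-bounded matrices -/

section PowerBounded

variable {S : Type*} [Fintype S] [DecidableEq S]

/-- For a power-bounded matrix, every vector is the sum of a fixed vector and a coboundary. -/
theorem exists_fixed_add_coboundary (A : Matrix S S ℝ) (hA : ∀ n s s', |(A ^ n) s s'| ≤ 1)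
    (v : S → ℝ) : ∃ k u : S → ℝ, A.mulVec k = k ∧ v = k + (u - A.mulVec u) := by
  have hbound : ∀ n (u : S → ℝ) s, |((A ^ n).mulVec u) s| ≤ ∑ s', |u s'| := by
    intro n u s
    refine (Finset.abs_sum_le_sum_abs _ _).trans (Finset.sum_le_sum fun s' _ => ?_)
    rw [abs_mul]
    exact mul_le_of_le_one_left (abs_nonneg _) (hA n s s')
  let f : (S → ℝ) →ₗ[ℝ] (S → ℝ) := LinearMap.id - A.mulVecLin
  have hf : ∀ u, f u = u - A.mulVec u := fun u => rfl
  -- If `w = u - A u` is fixed by `A`, then `A ^ n u = u - n w`; boundedness of the powers forces `w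
  -- = 0`. Rank-nullity then turns disjointness into a direct sum.
  have hdisj : Disjoint (LinearMap.ker f) (LinearMap.range f) := by
    rw [Submodule.disjoint_def]
    rintro w hw ⟨u, hu⟩
    have hfix : A.mulVec w = w := by
      rw [LinearMap.mem_ker, hf, sub_eq_zero] at hw
      exact hw.symm
    have hpow : ∀ n : ℕ, (A ^ n).mulVec u = u - (n : ℝ) • w := by
      intro n
      induction n with
      | zero => simp
      | succ n ih =>
        rw [pow_succ', ← Matrix.mulVec_mulVec, ih, Matrix.mulVec_sub, Matrix.mulVec_smul, hfix]
        have : A.mulVec u = u - w := by rw [← hu, hf]; abel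
        rw [this]
        push_cast
        rw [add_smul, one_smul]
        abel
    funext s
    by_contra hne
    have hpos : 0 < |w s| := abs_pos.mpr hne
    obtain ⟨n, hn⟩ := exists_nat_gt ((∑ s', |u s'| + |u s|) / |w s|)
    rw [div_lt_iff₀ hpos] at hn
    have h1 := hbound n u s
    rw [hpow n] at h1
    have h2 : (n : ℝ) * |w s| = |u s - (u s - n * w s)| := by
      rw [sub_sub_cancel, abs_mul, Nat.abs_cast]
    have h3 := abs_sub (u s) (u s - n * w s)
    simp only [Pi.sub_apply, Pi.smul_apply, smul_eq_mul] at h1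
    linarith
  have hcompl : IsCompl (LinearMap.ker f) (LinearMap.range f) := by
    refine (Submodule.isCompl_iff_disjoint _ _ ?_).mpr hdisj
    rw [add_comm, LinearMap.finrank_range_add_finrank_ker]
  have hv : v ∈ LinearMap.ker f ⊔ LinearMap.range f := by
    rw [hcompl.sup_eq_top]; trivial
  obtain ⟨k, hk, _, ⟨u, rfl⟩, rfl⟩ := Submodule.mem_sup.mp hv
  refine ⟨k, u, ?_, rfl⟩
  rw [LinearMap.mem_ker, hf, sub_eq_zero] at hk
  exact hk.symm

/-- The fixed part contributes itself to every average, while the coboundary telescopes to a bounded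
quantity that is divided by `T`. -/
theorem tendsto_cesaro_mulVec (A : Matrix S S ℝ) (hA : ∀ n s s', |(A ^ n) s s'| ≤ 1)
    {k u : S → ℝ} (hk : A.mulVec k = k) (s : S) :
    Tendsto (fun T : ℕ => (1 / (T : ℝ)) *
      ∑ t ∈ Finset.range T, ((A ^ t).mulVec (k + (u - A.mulVec u))) s) atTop (𝓝 (k s)) := by
  have hkpow : ∀ n : ℕ, (A ^ n).mulVec k = k := by
    intro n
    induction n with
    | zero => simp
    | succ n ih => rw [pow_succ, ← Matrix.mulVec_mulVec, hk, ih]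
  have hsum : ∀ T : ℕ, ∑ t ∈ Finset.range T, ((A ^ t).mulVec (k + (u - A.mulVec u))) s =
      T * k s + (u s - ((A ^ T).mulVec u) s) := by
    intro T
    induction T with
    | zero => simp
    | succ T ih =>
      rw [Finset.sum_range_succ, ih, Matrix.mulVec_add, Matrix.mulVec_sub, hkpow,
        Matrix.mulVec_mulVec, ← pow_succ]
      simp only [Pi.add_apply, Pi.sub_apply]
      push_cast
      ring
  have hb : ∀ T : ℕ, |u s - ((A ^ T).mulVec u) s| ≤ |u s| + ∑ s', |u s'| := by
    intro T
    refine (abs_sub _ _).trans (add_le_add le_rfl ?_)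
    refine (Finset.abs_sum_le_sum_abs _ _).trans (Finset.sum_le_sum fun s' _ => ?_)
    rw [abs_mul]
    exact mul_le_of_le_one_left (abs_nonneg _) (hA T s s')
  have hlim : Tendsto (fun T : ℕ => (1 / (T : ℝ)) * (u s - ((A ^ T).mulVec u) s)) atTop (𝓝 0) := by
    refine squeeze_zero_norm (a := fun T : ℕ => (|u s| + ∑ s', |u s'|) / (T : ℝ)) (fun T => ?_)
      (tendsto_const_div_atTop_nhds_zero_nat _)
    rw [Real.norm_eq_abs, abs_mul, abs_of_nonneg (one_div_nonneg.mpr T.cast_nonneg), mul_comm,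
      mul_one_div]
    exact div_le_div_of_nonneg_right (hb T) T.cast_nonneg
  have hlim' : Tendsto (fun T : ℕ => k s + (1 / (T : ℝ)) * (u s - ((A ^ T).mulVec u) s)) atTop
      (𝓝 (k s)) := by simpa using hlim.const_add (k s)
  refine hlim'.congr' ?_
  filter_upwards [eventually_gt_atTop 0] with T hT
  rw [hsum]
  have : (T : ℝ) ≠ 0 := by positivity
  field_simp

end PowerBounded

/-! ### Stochastic matrices: reachability and harmonic functions -/

section Stochastic

variable {S : Type*} [Fintype S] [DecidableEq S] {p : Matrix S S ℝ}

theorem stochastic_pow (hp0 : ∀ s s', 0 ≤ p s s') (hp1 : ∀ s, ∑ s', p s s' = 1) (n : ℕ) :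
    (∀ s s', 0 ≤ (p ^ n) s s') ∧ ∀ s, ∑ s', (p ^ n) s s' = 1 := by
  have h := (Matrix.mem_rowStochastic_iff_sum (R := ℝ) (M := p)).mpr ⟨hp0, hp1⟩
  exact Matrix.mem_rowStochastic_iff_sum.mp (pow_mem h n)

theorem abs_stochastic_pow_le_one (hp0 : ∀ s s', 0 ≤ p s s') (hp1 : ∀ s, ∑ s', p s s' = 1)
    (n : ℕ) (s s' : S) : |(p ^ n) s s'| ≤ 1 := by
  obtain ⟨h0, h1⟩ := stochastic_pow hp0 hp1 n
  rw [abs_of_nonneg (h0 s s'), ← h1 s]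
  exact Finset.single_le_sum (fun x _ => h0 s x) (Finset.mem_univ s')

theorem Reaches.refl (s : S) : Reaches p s s := ⟨0, by simp⟩

theorem Reaches.trans (hp0 : ∀ s s', 0 ≤ p s s') (hp1 : ∀ s, ∑ s', p s s' = 1) {x y z : S}
    (hxy : Reaches p x y) (hyz : Reaches p y z) : Reaches p x z := by
  obtain ⟨m, hm⟩ := hxy
  obtain ⟨n, hn⟩ := hyz
  refine ⟨m + n, ?_⟩
  rw [pow_add, Matrix.mul_apply]
  refine (mul_pos hm hn).trans_le (Finset.single_le_sum
    (f := fun j => (p ^ m) x j * (p ^ n) j z) (fun j _ => ?_) (Finset.mem_univ y))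
  exact mul_nonneg ((stochastic_pow hp0 hp1 m).1 _ _) ((stochastic_pow hp0 hp1 n).1 _ _)

/-- Reachability is a preorder whose maximal elements are exactly the recurrent states, and in a
finite preorder every element lies below a maximal one. -/
theorem exists_reaches_recurrent (hp0 : ∀ s s', 0 ≤ p s s') (hp1 : ∀ s, ∑ s', p s s' = 1)
    (s : S) : ∃ s' ∈ recurrentStates p, Reaches p s s' := by
  let _ : Preorder S :=
    { le := Reaches p
      le_refl := Reaches.refl
      le_trans := fun _ _ _ h h' => h.trans hp0 hp1 h' }
  obtain ⟨x, hx, hmax⟩ := Finite.exists_le_maximal (p := fun _ : S => True) (a := s) trivial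
  exact ⟨x, fun y hy => hmax.2 trivial hy, hx⟩

/-- Averages of a vector bounded by its value at `s` and equal to it propagate along the chain. -/
theorem eq_of_reaches_of_max (hp0 : ∀ s s', 0 ≤ p s s') (hp1 : ∀ s, ∑ s', p s s' = 1)
    {k : S → ℝ} (hk : p.mulVec k = k) {s y : S} (hmax : ∀ x, k x ≤ k s) (hsy : Reaches p s y) :
    k y = k s := by
  obtain ⟨n, hn⟩ := hsy
  have hkpow : (p ^ n).mulVec k = k := by
    clear hn
    induction n with
    | zero => simp
    | succ n ih => rw [pow_succ, ← Matrix.mulVec_mulVec, hk, ih]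
  obtain ⟨h0, h1⟩ := stochastic_pow hp0 hp1 n
  -- The row of `p ^ n` at `s` averages the deficits `k s - k x`, all nonnegative, to zero; so the
  -- deficit vanishes wherever the row has mass.
  have hz : ∑ x, (p ^ n) s x * (k s - k x) = 0 := by
    have := congrFun hkpow s
    simp only [Matrix.mulVec, dotProduct] at this
    simp only [mul_sub, Finset.sum_sub_distrib, ← Finset.sum_mul, h1, this]
    ring
  have := (Finset.sum_eq_zero_iff_of_nonneg
    (fun x _ => mul_nonneg (h0 s x) (sub_nonneg.mpr (hmax x)))).mp hz y (Finset.mem_univ _)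
  rcases mul_eq_zero.mp this with h | h
  · exact absurd h hn.ne'
  · linarith

/-- Harmonic functions of a unichain are constant. -/
theorem harmonic_eq (hp0 : ∀ s s', 0 ≤ p s s') (hp1 : ∀ s, ∑ s', p s s' = 1)
    (huni : IsUnichain p) {k : S → ℝ} (hk : p.mulVec k = k) (x y : S) : k x = k y := by
  have : Nonempty S := ⟨x⟩
  obtain ⟨a, ha⟩ := Finite.exists_max k
  obtain ⟨b, hb⟩ := Finite.exists_min k
  -- The maximum propagates along `a → a' → b'`, the middle link being the unichain condition, and
  -- the minimum along `b → b'`; the two extreme values meet at `b'`.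
  obtain ⟨a', ha', haa'⟩ := exists_reaches_recurrent hp0 hp1 a
  obtain ⟨b', hb', hbb'⟩ := exists_reaches_recurrent hp0 hp1 b
  have h1 := eq_of_reaches_of_max hp0 hp1 hk ha haa'
  have hk' : p.mulVec (-k) = -k := by rw [Matrix.mulVec_neg, hk]
  have h2 := eq_of_reaches_of_max hp0 hp1 hk' (s := b) (fun z => neg_le_neg (hb z)) hbb'
  have h3 := eq_of_reaches_of_max hp0 hp1 hk ha (haa'.trans hp0 hp1 (huni a' ha' b' hb'))
  simp only [Pi.neg_apply] at h2
  have := ha x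
  have := ha y
  have := hb x
  have := hb y
  linarith

end Stochastic

/-! ### Poisson equations and hitting times -/

section Hitting

variable {S : Type*} [Fintype S] {p : Matrix S S ℝ}

theorem avoidProb_nonneg (hp0 : ∀ s s', 0 ≤ p s s') (D : Set S) (t : ℕ) (s : S) :
    0 ≤ avoidProb p D t s := by
  induction t generalizing s with
  | zero => unfold avoidProb; split_ifs <;> norm_num
  | succ t ih =>
    unfold avoidProb
    split_ifs
    · exact le_rfl
    · exact Finset.sum_nonneg fun s' _ => mul_nonneg (hp0 s s') (ih s')

/-- Unfold the Poisson equation `n` times, stopping on entry to `D`: each step taken outside `D`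
costs at most one, entry costs at most `b`, and the crude excess `m` is paid only on the event that
`D` is still avoided. -/
theorem abs_sub_le_add_sum_avoidProb (hp0 : ∀ s s', 0 ≤ p s s') (hp1 : ∀ s, ∑ s', p s s' = 1)
    {V g : S → ℝ} (hV : ∀ s, V s = g s + ∑ s', p s s' * V s') (hg : ∀ s, |g s| ≤ 1)
    (D : Set S) {b c m : ℝ} (hD : ∀ s ∈ D, |V s - c| ≤ b)
    (hall : ∀ s, |V s - c| ≤ b + m) (n : ℕ) (s : S) :
    |V s - c| ≤ b + ∑ t ∈ Finset.range n, avoidProb p D t s + m * avoidProb p D n s := by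
  by_cases hs : s ∈ D
  · have hz : ∀ t, avoidProb p D t s = 0 := by
      intro t
      cases t <;> simp [avoidProb, hs]
    simpa [hz] using hD s hs
  induction n generalizing s with
  | zero => simpa [avoidProb, hs] using hall s
  | succ n ih =>
    -- The induction covers only states outside `D`, but a successor of `s` may lie in `D`, where
    -- all avoidance probabilities vanish.
    have ih' : ∀ x, |V x - c| ≤ b + ∑ t ∈ Finset.range n, avoidProb p D t x
        + m * avoidProb p D n x := by
      intro x
      by_cases hx : x ∈ D
      · have hz : ∀ t, avoidProb p D t x = 0 := by
          intro t
          cases t <;> simp [avoidProb, hx]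
        simpa [hz] using hD x hx
      · exact ih x hx
    have hsucc : ∀ t, avoidProb p D (t + 1) s = ∑ s', p s s' * avoidProb p D t s' := by
      intro t
      simp [avoidProb, hs]
    have h0 : avoidProb p D 0 s = 1 := by simp [avoidProb, hs]
    have hdec : V s - c = g s + ∑ s', p s s' * (V s' - c) := by
      simp only [mul_sub, Finset.sum_sub_distrib, ← Finset.sum_mul, hp1]
      linarith [hV s]
    have hsum : |∑ s', p s s' * (V s' - c)| ≤ ∑ s', p s s' *
        (b + ∑ t ∈ Finset.range n, avoidProb p D t s' + m * avoidProb p D n s') := by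
      refine (Finset.abs_sum_le_sum_abs _ _).trans (Finset.sum_le_sum fun s' _ => ?_)
      rw [abs_mul, abs_of_nonneg (hp0 s s')]
      exact mul_le_mul_of_nonneg_left (ih' s') (hp0 s s')
    have heq : ∑ s', p s s' *
        (b + ∑ t ∈ Finset.range n, avoidProb p D t s' + m * avoidProb p D n s') =
        b + ∑ t ∈ Finset.range n, avoidProb p D (t + 1) s + m * avoidProb p D (n + 1) s := by
      simp only [hsucc, mul_add, Finset.sum_add_distrib, ← Finset.sum_mul, hp1, one_mul,
        Finset.mul_sum]
      rw [Finset.sum_comm]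
      congr 1
      exact Finset.sum_congr rfl fun _ _ => by ring
    -- The term `t = 0` equals one and pays for `g s`; the later terms are averages of the
    -- successors' terms.
    rw [Finset.sum_range_succ', h0, hdec]
    have := abs_add_le (g s) (∑ s', p s s' * (V s' - c))
    have := hg s
    linarith

/-- A solution of a Poisson equation with source bounded by one varies by at most the expected
time to reach a set. -/
theorem ofReal_abs_sub_le_expectedHit (hp0 : ∀ s s', 0 ≤ p s s') (hp1 : ∀ s, ∑ s', p s s' = 1)
    {V g : S → ℝ} (hV : ∀ s, V s = g s + ∑ s', p s s' * V s') (hg : ∀ s, |g s| ≤ 1)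
    (D : Set S) {b c : ℝ} (hb : 0 ≤ b) (hD : ∀ s ∈ D, |V s - c| ≤ b) (s : S) :
    ENNReal.ofReal |V s - c| ≤ ENNReal.ofReal b + expectedHit p D s := by
  by_cases htop : expectedHit p D s = ⊤
  · simp [htop]
  have hnn : ∀ t, 0 ≤ avoidProb p D t s := fun t => avoidProb_nonneg hp0 D t s
  have hsummable : Summable fun t => avoidProb p D t s := by
    have := ENNReal.summable_toReal htop
    simpa [ENNReal.toReal_ofReal, hnn] using this
  have heq : expectedHit p D s = ENNReal.ofReal (∑' t, avoidProb p D t s) :=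
    (ENNReal.ofReal_tsum_of_nonneg hnn hsummable).symm
  rw [heq, ← ENNReal.ofReal_add hb (tsum_nonneg hnn)]
  refine ENNReal.ofReal_le_ofReal ?_
  -- Any finite bound would do: its coefficient is a term of a convergent series and disappears in
  -- the limit.
  set m := ∑ x, |V x - c|
  have hall : ∀ x, |V x - c| ≤ b + m := fun x =>
    (Finset.single_le_sum (f := fun x => |V x - c|) (fun x _ => abs_nonneg _)
      (Finset.mem_univ x)).trans (by linarith)
  have hlim : Tendsto (fun n => b + ∑ t ∈ Finset.range n, avoidProb p D t s
      + m * avoidProb p D n s) atTop (𝓝 (b + ∑' t, avoidProb p D t s + m * 0)) :=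
    (hsummable.hasSum.tendsto_sum_nat.const_add b).add
      (hsummable.tendsto_atTop_zero.const_mul m)
  have := ge_of_tendsto' hlim fun n =>
    abs_sub_le_add_sum_avoidProb hp0 hp1 hV hg D hD hall n s
  linarith

end Hitting

/-! ### Stationary averages, the Bellman equation and the span of the value function -/

section Policy

variable {S A : Type*} [Fintype S] [Fintype A]
  {M : MDP S A} {π : S → A → ℝ}

theorem transition_nonneg (hπ : IsPolicy π) (s s' : S) : 0 ≤ transition M π s s' :=
  Finset.sum_nonneg fun a _ => mul_nonneg (M.P_nonneg s a s') (hπ.1 s a)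

theorem transition_sum (hπ : IsPolicy π) (s : S) : ∑ s', transition M π s s' = 1 := by
  simp only [transition, Matrix.of_apply]
  rw [Finset.sum_comm]
  simp only [← Finset.sum_mul, M.P_sum, one_mul, hπ.2]

theorem sum_transition_mul (s : S) (V : S → ℝ) :
    ∑ s', transition M π s s' * V s' = ∑ a, π s a * ∑ s', M.P s a s' * V s' := by
  simp only [transition, Matrix.of_apply, Finset.sum_mul, Finset.mul_sum]
  rw [Finset.sum_comm]
  exact Finset.sum_congr rfl fun _ _ => Finset.sum_congr rfl fun _ _ => by ring

theorem policyReward_mem (hπ : IsPolicy π) (s : S) :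
    0 ≤ ∑ a, π s a * M.r s a ∧ ∑ a, π s a * M.r s a ≤ 1 := by
  refine ⟨Finset.sum_nonneg fun a _ => mul_nonneg (hπ.1 s a) (M.r_nonneg s a), ?_⟩
  rw [← hπ.2 s]
  exact Finset.sum_le_sum fun a _ => mul_le_of_le_one_right (hπ.1 s a) (M.r_le_one s a)

variable [DecidableEq S]

theorem stateProb_nonneg (hπ : IsPolicy π) (t : ℕ) (s : S) : 0 ≤ stateProb M π t s :=
  Finset.sum_nonneg fun x _ => mul_nonneg (M.ρ_nonneg x)
    ((stochastic_pow (transition_nonneg hπ) (transition_sum hπ) t).1 x s)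

theorem stateProb_sum (hπ : IsPolicy π) (t : ℕ) : ∑ s, stateProb M π t s = 1 := by
  simp only [stateProb, Matrix.vecMul, dotProduct]
  rw [Finset.sum_comm]
  simp only [← Finset.mul_sum, (stochastic_pow (transition_nonneg hπ) (transition_sum hπ) t).2,
    mul_one, M.ρ_sum]

/-- The row vector `ρ` is decomposed by the transposed matrix, whose powers have the same entrywise
bound. Its fixed part is both the Cesàro limit and a stationary vector, so `limUnder` denotes a true
limit. -/
theorem occupancy_spec (hπ : IsPolicy π) :
    (∀ s', ∑ s, occupancy M π s * transition M π s s' = occupancy M π s') ∧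
    ∀ s, Tendsto (fun T : ℕ => (1 / (T : ℝ)) * ∑ t ∈ Finset.range T, stateProb M π t s) atTop
      (𝓝 (occupancy M π s)) := by
  set p := transition M π with hp
  have hbd := abs_stochastic_pow_le_one (transition_nonneg (M := M) hπ) (transition_sum hπ)
  have hT : ∀ n s s', |(p.transpose ^ n) s s'| ≤ 1 := by
    intro n s s'
    rw [← Matrix.transpose_pow]
    exact hbd n s' s
  obtain ⟨k, u, hk, hρ⟩ := exists_fixed_add_coboundary p.transpose hT M.ρ
  have hlim : ∀ s, Tendsto (fun T : ℕ => (1 / (T : ℝ)) *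
      ∑ t ∈ Finset.range T, stateProb M π t s) atTop (𝓝 (k s)) := by
    intro s
    have := tendsto_cesaro_mulVec p.transpose hT (u := u) hk s
    rw [← hρ] at this
    refine this.congr fun T => ?_
    congr 1
    refine Finset.sum_congr rfl fun t _ => ?_
    rw [← Matrix.transpose_pow, Matrix.mulVec_transpose]
    rfl
  have hocc : occupancy M π = k := funext fun s => (hlim s).limUnder_eq
  rw [hocc]
  refine ⟨fun s' => ?_, hlim⟩
  have := congrFun hk s'
  rw [Matrix.mulVec_transpose] at this
  exact this

theorem occupancy_nonneg (hπ : IsPolicy π) (s : S) : 0 ≤ occupancy M π s :=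
  ge_of_tendsto' ((occupancy_spec hπ).2 s) fun T =>
    mul_nonneg (by positivity) (Finset.sum_nonneg fun t _ => stateProb_nonneg hπ t s)

theorem occupancy_sum (hπ : IsPolicy π) : ∑ s, occupancy M π s = 1 := by
  have h := tendsto_finsetSum Finset.univ fun s _ => (occupancy_spec (M := M) hπ).2 s
  refine tendsto_nhds_unique h (tendsto_const_nhds.congr' ?_)
  filter_upwards [eventually_gt_atTop 0] with T hT
  have : (T : ℝ) ≠ 0 := by positivity
  rw [← Finset.mul_sum, Finset.sum_comm]
  simp only [stateProb_sum hπ, Finset.sum_const, Finset.card_range, nsmul_eq_mul, mul_one]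
  field_simp

theorem sum_occupancy_mul_transition (hπ : IsPolicy π) (V : S → ℝ) :
    ∑ s, occupancy M π s * ∑ s', transition M π s s' * V s' = ∑ s, occupancy M π s * V s := by
  simp only [Finset.mul_sum]
  rw [Finset.sum_comm]
  simp only [← mul_assoc, ← Finset.sum_mul, (occupancy_spec hπ).1]

theorem avgReward_eq (hπ : IsPolicy π) :
    avgReward M π = ∑ s, occupancy M π s * ∑ a, π s a * M.r s a := by
  refine Tendsto.limUnder_eq ?_
  have h := tendsto_finsetSum Finset.univ fun s _ =>
    ((occupancy_spec (M := M) hπ).2 s).mul_const (∑ a, π s a * M.r s a)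
  refine h.congr fun T => ?_
  simp only [mul_assoc, ← Finset.mul_sum, Finset.sum_mul]
  congr 1
  rw [Finset.sum_comm]

theorem avgReward_mem (hπ : IsPolicy π) : 0 ≤ avgReward M π ∧ avgReward M π ≤ 1 := by
  rw [avgReward_eq hπ]
  refine ⟨Finset.sum_nonneg fun s _ =>
    mul_nonneg (occupancy_nonneg hπ s) (policyReward_mem hπ s).1, ?_⟩
  rw [← occupancy_sum (M := M) hπ]
  exact Finset.sum_le_sum fun s _ =>
    mul_le_of_le_one_right (occupancy_nonneg hπ s) (policyReward_mem hπ s).2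

/-- Decompose the reward vector of the policy as a harmonic part plus `V - P V`. The harmonic part
is constant on a unichain, and pairing with the stationary distribution identifies it as the average
reward. One-step lookahead from `V` gives `Q`. -/
theorem exists_isBellman (hπ : IsPolicy π) (huni : IsUnichain (transition M π)) :
    ∃ Q, IsBellman M π Q := by
  have hp0 := transition_nonneg (M := M) hπ
  have hp1 := transition_sum (M := M) hπ
  obtain ⟨k, V, hk, hr⟩ := exists_fixed_add_coboundary (transition M π)
    (abs_stochastic_pow_le_one hp0 hp1) fun s => ∑ a, π s a * M.r s a
  have hJ : ∀ s, k s = avgReward M π := by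
    intro s
    rw [avgReward_eq hπ]
    have h := congrArg (fun f : S → ℝ => ∑ x, occupancy M π x * f x) hr
    simp only [Pi.add_apply, Pi.sub_apply, mul_add, mul_sub, Finset.sum_add_distrib,
      Finset.sum_sub_distrib] at h
    have h2 := sum_occupancy_mul_transition (M := M) hπ V
    simp only [Matrix.mulVec, dotProduct] at h
    rw [h2, sub_self, add_zero] at h
    have hks : ∀ x, k x = k s := fun x => harmonic_eq hp0 hp1 huni hk x s
    simp only [h, hks, ← Finset.sum_mul, occupancy_sum hπ, one_mul]
  refine ⟨fun s a => M.r s a - avgReward M π + ∑ s', M.P s a s' * V s', fun s a => ?_⟩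
  have hV : ∀ x, ∑ b, π x b * (M.r x b - avgReward M π + ∑ y, M.P x b y * V y) = V x := by
    intro x
    have h := congrFun hr x
    simp only [Pi.add_apply, Pi.sub_apply, Matrix.mulVec, dotProduct, hJ x,
      sum_transition_mul] at h
    simp only [mul_add, mul_sub, Finset.sum_add_distrib, Finset.sum_sub_distrib,
      ← Finset.sum_mul, hπ.2, one_mul]
    linarith
  simp only [hV]

theorem qValue_isBellman (hπ : IsPolicy π) (huni : IsUnichain (transition M π)) :
    IsBellman M π (qValue M π) := Classical.epsilon_spec (exists_isBellman hπ huni)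

theorem qValue_eq (hπ : IsPolicy π) (huni : IsUnichain (transition M π)) (s : S) (a : A) :
    qValue M π s a = M.r s a - avgReward M π + ∑ s', M.P s a s' * vValue M π s' :=
  qValue_isBellman hπ huni s a

theorem vValue_eq (hπ : IsPolicy π) (huni : IsUnichain (transition M π)) (s : S) :
    vValue M π s = (∑ a, π s a * M.r s a - avgReward M π)
      + ∑ s', transition M π s s' * vValue M π s' := by
  rw [vValue, sum_transition_mul]
  simp only [qValue_eq hπ huni, mul_add, mul_sub, Finset.sum_add_distrib,
    Finset.sum_sub_distrib, ← Finset.sum_mul, hπ.2, one_mul]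

/-- The performance difference lemma. -/
theorem performance_difference (hπ : IsPolicy π) (huni : IsUnichain (transition M π))
    {π' : S → A → ℝ} (hπ' : IsPolicy π') :
    ∑ s, ∑ a, occupancy M π' s * π' s a * advantage M π s a =
      avgReward M π' - avgReward M π := by
  -- The two value terms differ state by state, but cancel after summation because the occupancy of
  -- `π'` is stationary under `π'`.
  have h : ∀ s, ∑ a, occupancy M π' s * π' s a * advantage M π s a =
      occupancy M π' s * ∑ a, π' s a * M.r s a - occupancy M π' s * avgReward M π
      + occupancy M π' s * ∑ s', transition M π' s s' * vValue M π s'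
      - occupancy M π' s * vValue M π s := by
    intro s
    rw [sum_transition_mul, ← mul_sub, ← mul_add, ← mul_sub]
    simp only [mul_assoc, ← Finset.mul_sum]
    congr 1
    simp only [advantage, qValue_eq hπ huni, mul_add, mul_sub, Finset.sum_add_distrib,
      Finset.sum_sub_distrib, ← Finset.sum_mul, hπ'.2, one_mul]
  simp only [h, Finset.sum_add_distrib, Finset.sum_sub_distrib,
    sum_occupancy_mul_transition hπ', ← Finset.sum_mul, occupancy_sum hπ', ← avgReward_eq hπ']
  ring

/-- From a recurrent state, average over targets `y` the bound of `|V x - V y|` by the hitting time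
of `y`; this gives `cTar`. From any other state, first wait for the recurrent class, with the bound
just found as boundary value; this adds `cHit`. -/
theorem abs_vValue_sub_mean_le (hπ : IsPolicy π) (huni : IsUnichain (transition M π)) (s : S) :
    ENNReal.ofReal |vValue M π s - ∑ y, occupancy M π y * vValue M π y| ≤
      cHit M π + cTar M π := by
  have hp0 := transition_nonneg (M := M) hπ
  have hp1 := transition_sum (M := M) hπ
  have hV := vValue_eq hπ huni
  have hg : ∀ s, |∑ a, π s a * M.r s a - avgReward M π| ≤ 1 := by
    intro s
    have h1 := policyReward_mem (M := M) hπ s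
    have h2 := avgReward_mem (M := M) hπ
    rw [abs_le]
    constructor <;> linarith [h1.1, h1.2, h2.1, h2.2]
  set c := ∑ y, occupancy M π y * vValue M π y with hc
  have hrec : ∀ x ∈ recurrentStates (transition M π),
      ENNReal.ofReal |vValue M π x - c| ≤ cTar M π := by
    intro x hx
    refine le_trans ?_ (le_iSup₂ (f := fun x (_ : x ∈ recurrentStates (transition M π)) =>
      ∑ s', ENNReal.ofReal (occupancy M π s') * expectedHit (transition M π) {s'} x) x hx)
    have h1 : |vValue M π x - c| ≤ ∑ y, occupancy M π y * |vValue M π x - vValue M π y| := by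
      have : vValue M π x - c = ∑ y, occupancy M π y * (vValue M π x - vValue M π y) := by
        simp only [mul_sub, Finset.sum_sub_distrib, ← Finset.sum_mul, occupancy_sum hπ, one_mul,
          hc]
      rw [this]
      refine (Finset.abs_sum_le_sum_abs _ _).trans (Finset.sum_le_sum fun y _ => ?_)
      rw [abs_mul, abs_of_nonneg (occupancy_nonneg hπ y)]
    refine (ENNReal.ofReal_le_ofReal h1).trans ?_
    rw [ENNReal.ofReal_sum_of_nonneg fun y _ =>
      mul_nonneg (occupancy_nonneg hπ y) (abs_nonneg _)]
    refine Finset.sum_le_sum fun y _ => ?_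
    rw [ENNReal.ofReal_mul (occupancy_nonneg hπ y)]
    gcongr
    have := ofReal_abs_sub_le_expectedHit hp0 hp1 hV hg {y} (b := 0) (c := vValue M π y) le_rfl
      (by rintro z rfl; simp) x
    simpa using this
  by_cases htop : cTar M π = ⊤
  · simp [htop]
  have h := ofReal_abs_sub_le_expectedHit hp0 hp1 hV hg (recurrentStates (transition M π))
    (b := (cTar M π).toReal) (c := c) ENNReal.toReal_nonneg
    (fun x hx => (ENNReal.ofReal_le_iff_le_toReal htop).mp (hrec x hx)) s
  rw [ENNReal.ofReal_toReal htop, add_comm] at h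
  exact h.trans (add_le_add_left
    (le_iSup (fun s => expectedHit (transition M π) (recurrentStates (transition M π)) s) s) _)

/-- The span of the value function is at most `2 (C_hit + C_tar)`. -/
theorem vValue_sub_le (hπ : IsPolicy π) (huni : IsUnichain (transition M π)) {C : ℝ}
    (hC : cHit M π + cTar M π ≤ ENNReal.ofReal C) (hC0 : 0 ≤ C) (x y : S) :
    vValue M π x - vValue M π y ≤ 2 * C := by
  have hx := (ENNReal.ofReal_le_ofReal_iff hC0).mp ((abs_vValue_sub_mean_le hπ huni x).trans hC)
  have hy := (ENNReal.ofReal_le_ofReal_iff hC0).mp ((abs_vValue_sub_mean_le hπ huni y).trans hC)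
  rw [abs_le] at hx hy
  linarith [hx.2, hy.1]

end Policy

/-! ### Quadratic bounds from Lipschitz gradients -/

section Smoothness

variable {E : Type*} [NormedAddCommGroup E] [InnerProductSpace ℝ E]

/-- On a nonempty open set, a Lipschitz constant enters a quadratic bound as if nonnegative. -/
theorem half_mul_norm_sq_le {F : Type*} [NormedAddCommGroup F] {g : E → F} {Θ : Set E}
    (hΘ : IsOpen Θ) {G : ℝ} (hG : ∀ x ∈ Θ, ∀ y ∈ Θ, ‖g x - g y‖ ≤ G * ‖x - y‖)
    {x : E} (hx : x ∈ Θ) (v : E) {w u : E} {c : ℝ} (hwu : ‖w‖ ^ 2 ≤ ‖u‖ ^ 2 / c) :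
    G / 2 * ‖v‖ ^ 2 ≤ G * (‖v - w‖ ^ 2 + ‖u‖ ^ 2 / c) := by
  by_cases hE : Subsingleton E
  -- In the zero space the hypothesis does not force `G ≥ 0`, but all vectors vanish.
  · simp [Subsingleton.elim v 0, Subsingleton.elim w 0, Subsingleton.elim u 0]
  have hG0 : 0 ≤ G := by
    rw [not_subsingleton_iff_nontrivial] at hE
    obtain ⟨ε, hε, hball⟩ := Metric.isOpen_iff.mp hΘ x hx
    obtain ⟨e, he⟩ := exists_norm_eq E (half_pos hε).le
    have hy : x + e ∈ Θ := hball (by simp [he, hε])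
    have h := (norm_nonneg _).trans (hG _ hy x hx)
    rw [add_sub_cancel_left, he] at h
    exact nonneg_of_mul_nonneg_left h (half_pos hε)
  have h := norm_add_le (v - w) w
  rw [sub_add_cancel] at h
  have h2 : ‖v‖ ^ 2 ≤ 2 * (‖v - w‖ ^ 2 + ‖u‖ ^ 2 / c) := by
    nlinarith [norm_nonneg v, norm_nonneg w, norm_nonneg (v - w), sq_nonneg (‖v - w‖ - ‖w‖)]
  nlinarith

variable [CompleteSpace E]

/-- The descent lemma for functions with Lipschitz gradient on a convex set. -/
theorem inner_gradient_sub_le {f : E → ℝ} {Θ : Set E} (hΘ : Convex ℝ Θ)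
    (hf : ∀ θ ∈ Θ, DifferentiableAt ℝ f θ) {G : ℝ}
    (hG : ∀ x ∈ Θ, ∀ y ∈ Θ, ‖gradient f x - gradient f y‖ ≤ G * ‖x - y‖)
    {x y : E} (hx : x ∈ Θ) (hy : y ∈ Θ) :
    inner ℝ (gradient f x) (y - x) - G / 2 * ‖y - x‖ ^ 2 ≤ f y - f x := by
  set v := y - x with hv
  have hmem : ∀ t ∈ Set.Icc (0 : ℝ) 1, x + t • v ∈ Θ := fun t ht =>
    hΘ.add_smul_sub_mem hx hy ht
  -- The gap between `f` and its quadratic lower model along the segment, up to a constant. The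
  -- Lipschitz bound and Cauchy-Schwarz make it nondecreasing.
  let h : ℝ → ℝ := fun t => f (x + t • v) - t * inner ℝ (gradient f x) v + G / 2 * ‖v‖ ^ 2 * t ^ 2
  have hderiv : ∀ t ∈ Set.Icc (0 : ℝ) 1, HasDerivAt h
      (inner ℝ (gradient f (x + t • v)) v - inner ℝ (gradient f x) v + G * ‖v‖ ^ 2 * t) t := by
    intro t ht
    have h1 : HasDerivAt (fun t : ℝ => x + t • v) v t := by
      simpa using ((hasDerivAt_id t).smul_const v).const_add x
    have h2 := (hf _ (hmem t ht)).hasGradientAt.hasFDerivAt.comp_hasDerivAt t h1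
    have h3 := (h2.sub ((hasDerivAt_id t).mul_const (inner ℝ (gradient f x) v))).add
      ((hasDerivAt_pow 2 t).const_mul (G / 2 * ‖v‖ ^ 2))
    refine h3.congr_deriv ?_
    simp only [InnerProductSpace.toDual_apply_apply]
    push_cast
    ring
  have hmono : MonotoneOn h (Set.Icc 0 1) := by
    refine monotoneOn_of_deriv_nonneg (convex_Icc 0 1)
      (fun t ht => (hderiv t ht).continuousAt.continuousWithinAt)
      (fun t ht => (hderiv t (interior_subset ht)).differentiableAt.differentiableWithinAt)
      fun t ht => ?_
    have ht' := interior_subset ht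
    rw [(hderiv t ht').deriv, ← inner_sub_left]
    have h1 := hG _ (hmem t ht') x hx
    rw [add_sub_cancel_left, norm_smul, Real.norm_eq_abs, abs_of_nonneg ht'.1] at h1
    have h2 := abs_real_inner_le_norm (gradient f (x + t • v) - gradient f x) v
    have h3 := mul_le_mul_of_nonneg_right h1 (norm_nonneg v)
    have h4 := (abs_le.mp (h2.trans h3)).1
    nlinarith
  have := hmono (Set.left_mem_Icc.mpr zero_le_one) (Set.right_mem_Icc.mpr zero_le_one) zero_le_one
  simp only [h, zero_smul, add_zero, one_smul, hv, add_sub_cancel] at this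
  rw [hv]
  linarith

end Smoothness

/-- For `x = F⁻¹ g`, positivity gives `μ ‖x‖² ≤ ⟨x, F x⟩ = ⟨x, g⟩ ≤ ‖x‖ ‖g‖`. Since `F = (F - μ) +
μ` is positive definite, the matrix inverse is a genuine one. -/
theorem norm_inv_mulVec_le {d : ℕ} {F : Matrix (Fin d) (Fin d) ℝ} {μ : ℝ} (hμ : 0 < μ)
    (hF : (F - μ • (1 : Matrix (Fin d) (Fin d) ℝ)).PosSemidef) (g : Vec d) :
    μ * ‖(WithLp.toLp 2 (F⁻¹.mulVec fun i => g i) : Vec d)‖ ≤ ‖g‖ := by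
  have hpd : F.PosDef := by
    have := Matrix.PosDef.posSemidef_add hF ((Matrix.PosDef.one (n := Fin d) (R := ℝ)).smul hμ)
    rwa [sub_add_cancel] at this
  have hdet : IsUnit F.det := (Matrix.isUnit_iff_isUnit_det _).mp hpd.isUnit
  set x : Fin d → ℝ := F⁻¹.mulVec fun i => g i with hx
  set w : Vec d := WithLp.toLp 2 x with hw
  have hFx : F.mulVec x = fun i => g i := by
    rw [hx, Matrix.mulVec_mulVec, Matrix.mul_nonsing_inv _ hdet, Matrix.one_mulVec]
  have hpsd := hF.dotProduct_mulVec_nonneg x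
  rw [Matrix.sub_mulVec, hFx, Matrix.smul_mulVec, Matrix.one_mulVec, dotProduct_sub,
    dotProduct_smul] at hpsd
  have h1 : ‖w‖ ^ 2 = star x ⬝ᵥ x := by
    rw [EuclideanSpace.real_norm_sq_eq]
    simp [dotProduct, hw, sq]
  have h2 : inner ℝ w g = star x ⬝ᵥ (fun i => g i) := by
    simp [PiLp.inner_apply, dotProduct, hw, mul_comm]
  rw [← h1, ← h2, smul_eq_mul] at hpsd
  have h3 := real_inner_le_norm w g
  rcases (norm_nonneg w).eq_or_lt with h0 | h0
  · rw [← h0, mul_zero]; exact norm_nonneg g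
  · nlinarith

/-! ### Expected KL divergence and the one-step policy improvement -/

section Policy

variable {S A : Type*} [Fintype S] [DecidableEq S] [Fintype A] {M : MDP S A}

/-- Gibbs' inequality from `1 - 1/z ≤ log z`. It permits dropping the final divergence from the
telescoped sum. -/
theorem expectedKL_nonneg {π₁ π₂ : S → A → ℝ} (h₁ : IsPolicy π₁) (h₂ : IsPolicy π₂)
    (hpos : ∀ s a, 0 < π₂ s a) : 0 ≤ expectedKL M π₁ π₂ := by
  refine Finset.sum_nonneg fun s _ => mul_nonneg (occupancy_nonneg h₁ s) ?_
  have h : ∀ a, π₁ s a - π₂ s a ≤ π₁ s a * Real.log (π₁ s a / π₂ s a) := by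
    intro a
    rcases (h₁.1 s a).eq_or_lt with h0 | h0
    · simp [← h0, (hpos s a).le]
    · have := mul_le_mul_of_nonneg_left
        (Real.one_sub_inv_le_log_of_pos (div_pos h0 (hpos s a))) h0.le
      refine le_trans (le_of_eq ?_) this
      have := (hpos s a).ne'
      field_simp
  refine le_trans (le_of_eq ?_) (Finset.sum_le_sum fun a _ => h a)
  rw [Finset.sum_sub_distrib, h₁.2, h₂.2, sub_self]

theorem expectedKL_sub {π₀ π₁ π₂ : S → A → ℝ} (h₀ : IsPolicy π₀)
    (h₁ : ∀ s a, 0 < π₁ s a) (h₂ : ∀ s a, 0 < π₂ s a) :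
    expectedKL M π₀ π₁ - expectedKL M π₀ π₂ =
      ∑ s, ∑ a, occupancy M π₀ s * π₀ s a * (Real.log (π₂ s a) - Real.log (π₁ s a)) := by
  simp only [expectedKL, ← Finset.sum_sub_distrib, Finset.mul_sum]
  refine Finset.sum_congr rfl fun s _ => Finset.sum_congr rfl fun a _ => ?_
  rcases (h₀.1 s a).eq_or_lt with h | h
  · simp [← h]
  · rw [Real.log_div h.ne' (h₁ s a).ne', Real.log_div h.ne' (h₂ s a).ne']
    ring

theorem sum_occupancy_mul_policy {π : S → A → ℝ} (hπ : IsPolicy π) :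
    ∑ s, ∑ a, occupancy M π s * π s a = 1 := by
  simp only [← Finset.mul_sum, hπ.2, mul_one, occupancy_sum hπ]

variable {d : ℕ} {π : Vec d → S → A → ℝ} {Θ : Set (Vec d)} {πstar : S → A → ℝ}

/-- Cauchy-Schwarz for weights of total mass one; the factor 2 undoes the `1 / 2` in `transferLoss`.
-/
theorem sum_advantage_error_le (hπstar : IsPolicy πstar) (w θ : Vec d) :
    ∑ s, ∑ a, occupancy M πstar s * πstar s a *
      (advantage M (π θ) s a - inner ℝ w (score π θ s a)) ≤
      Real.sqrt (2 * transferLoss M π πstar w θ) := by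
  refine Real.le_sqrt_of_sq_le ?_
  have hc : ∀ z : S × A, 0 ≤ occupancy M πstar z.1 * πstar z.1 z.2 := fun z =>
    mul_nonneg (occupancy_nonneg hπstar _) (hπstar.1 _ _)
  have h := Finset.sum_sq_le_sum_mul_sum_of_sq_le_mul (Finset.univ : Finset (S × A))
    (r := fun z => occupancy M πstar z.1 * πstar z.1 z.2 *
      (advantage M (π θ) z.1 z.2 - inner ℝ w (score π θ z.1 z.2)))
    (f := fun z => occupancy M πstar z.1 * πstar z.1 z.2)
    (g := fun z => occupancy M πstar z.1 * πstar z.1 z.2 *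
      (advantage M (π θ) z.1 z.2 - inner ℝ w (score π θ z.1 z.2)) ^ 2)
    (fun z _ => hc z) (fun z _ => mul_nonneg (hc z) (sq_nonneg _)) (fun z _ => le_of_eq (by ring))
  simp only [Fintype.sum_prod_type, sum_occupancy_mul_policy hπstar, one_mul] at h
  rw [transferLoss]
  linarith

theorem sqrt_transferLoss_le (hε : epsBias M π Θ πstar ≠ ⊤) {θ : Vec d} (hθ : θ ∈ Θ) :
    Real.sqrt (2 * transferLoss M π πstar (npgDir M π θ) θ) ≤
      Real.sqrt (2 * (epsBias M π Θ πstar).toReal) := by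
  have h := le_iSup₂ (f := fun θ (_ : θ ∈ Θ) =>
    ENNReal.ofReal (transferLoss M π πstar (npgDir M π θ) θ)) θ hθ
  have h' := (ENNReal.ofReal_le_iff_le_toReal hε).mp h
  exact Real.sqrt_le_sqrt (by linarith)

/-- The score at `θ` averaged over the state-action distribution of `πstar`. -/
def meanScore (M : MDP S A) (π : Vec d → S → A → ℝ) (πstar : S → A → ℝ) (θ : Vec d) : Vec d :=
  ∑ s, ∑ a, (occupancy M πstar s * πstar s a) • score π θ s a

theorem inner_meanScore (θ w : Vec d) :
    inner ℝ (meanScore M π πstar θ) w =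
      ∑ s, ∑ a, occupancy M πstar s * πstar s a * inner ℝ (score π θ s a) w := by
  simp only [meanScore, sum_inner, real_inner_smul_left]

theorem norm_meanScore_le (hπstar : IsPolicy πstar) {θ : Vec d} {G : ℝ}
    (hG : ∀ s a, ‖score π θ s a‖ ≤ G) : ‖meanScore M π πstar θ‖ ≤ G := by
  have h : ‖meanScore M π πstar θ‖ ≤ ∑ s, ∑ a, occupancy M πstar s * πstar s a * G := by
    refine (norm_sum_le _ _).trans (Finset.sum_le_sum fun s _ => ?_)
    refine (norm_sum_le _ _).trans (Finset.sum_le_sum fun a _ => ?_)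
    have hc := mul_nonneg (occupancy_nonneg (M := M) hπstar s) (hπstar.1 s a)
    rw [norm_smul, Real.norm_of_nonneg hc]
    exact mul_le_mul_of_nonneg_left (hG s a) hc
  simpa only [← Finset.sum_mul, sum_occupancy_mul_policy hπstar, one_mul] using h

/-- One step of an approximate natural policy gradient update. -/
theorem suboptimality_le
    (hΘ_open : IsOpen Θ) (hΘ_convex : Convex ℝ Θ)
    (hπ : ∀ θ ∈ Θ, IsPolicy (π θ)) (hπ_pos : ∀ θ ∈ Θ, ∀ s a, 0 < π θ s a)
    (hπ_diff : ∀ θ ∈ Θ, ∀ s a, DifferentiableAt ℝ (fun θ' => Real.log (π θ' s a)) θ)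
    (hunichain : ∀ θ ∈ Θ, IsUnichain (transition M (π θ)))
    {G₂ : ℝ}
    (hG₂ : ∀ θ₁ ∈ Θ, ∀ θ₂ ∈ Θ, ∀ s a, ‖score π θ₁ s a - score π θ₂ s a‖ ≤ G₂ * ‖θ₁ - θ₂‖)
    {μ : ℝ} (hμ : 0 < μ)
    (hfisher : ∀ θ ∈ Θ, (fisher M π θ - μ • (1 : Matrix (Fin d) (Fin d) ℝ)).PosSemidef)
    (hπstar : IsPolicy πstar) (hε : epsBias M π Θ πstar ≠ ⊤)
    {α : ℝ} (hα : 0 < α) {θ w : Vec d} (hθ : θ ∈ Θ) (hθ' : θ + α • w ∈ Θ) :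
    avgReward M πstar - objective M π θ ≤
      Real.sqrt (2 * (epsBias M π Θ πstar).toReal)
      + inner ℝ (meanScore M π πstar θ) (npgDir M π θ - w)
      + (expectedKL M πstar (π θ) - expectedKL M πstar (π (θ + α • w))) / α
      + α * G₂ * (‖w - npgDir M π θ‖ ^ 2 + ‖gradient (objective M π) θ‖ ^ 2 / μ ^ 2) := by
  have hc : ∀ s a, 0 ≤ occupancy M πstar s * πstar s a := fun s a =>
    mul_nonneg (occupancy_nonneg hπstar s) (hπstar.1 s a)
  have hpd := performance_difference (hπ θ hθ) (hunichain θ hθ) hπstar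
  have herr := (sum_advantage_error_le (M := M) (π := π) hπstar (npgDir M π θ) θ).trans
    (sqrt_transferLoss_le hε hθ)
  have hsplit : ∑ s, ∑ a, occupancy M πstar s * πstar s a *
      (advantage M (π θ) s a - inner ℝ (npgDir M π θ) (score π θ s a)) =
      (avgReward M πstar - objective M π θ)
        - inner ℝ (meanScore M π πstar θ) (npgDir M π θ) := by
    rw [inner_meanScore, objective, ← hpd]
    simp only [mul_sub, Finset.sum_sub_distrib, real_inner_comm]
  -- Some score function is needed to extract the sign of `G₂`; weights summing to one rule out an
  -- empty index set.
  have hne : Nonempty (S × A) := by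
    by_contra hempty
    have := sum_occupancy_mul_policy (M := M) hπstar
    rw [← Fintype.sum_prod_type', not_nonempty_iff] at *
    simp at this
  obtain ⟨s₀, a₀⟩ := hne
  -- The descent lemma for each `log π_θ(a|s)`, averaged over the state-action distribution of
  -- `πstar`.
  have hlog : α * inner ℝ (meanScore M π πstar θ) w - G₂ / 2 * (α ^ 2 * ‖w‖ ^ 2) ≤
      expectedKL M πstar (π θ) - expectedKL M πstar (π (θ + α • w)) := by
    rw [expectedKL_sub hπstar (hπ_pos θ hθ) (hπ_pos _ hθ')]
    have hsa : ∀ s a, α * inner ℝ (score π θ s a) w - G₂ / 2 * (α ^ 2 * ‖w‖ ^ 2) ≤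
        Real.log (π (θ + α • w) s a) - Real.log (π θ s a) := by
      intro s a
      have := inner_gradient_sub_le hΘ_convex (fun θ hθ => hπ_diff θ hθ s a)
        (fun x hx y hy => hG₂ x hx y hy s a) hθ hθ'
      rw [add_sub_cancel_left, real_inner_smul_right, norm_smul, mul_pow, Real.norm_eq_abs,
        sq_abs] at this
      exact this
    refine le_trans (le_of_eq ?_) (Finset.sum_le_sum fun s _ => Finset.sum_le_sum fun a _ =>
      mul_le_mul_of_nonneg_left (hsa s a) (hc s a))
    simp only [mul_sub, Finset.sum_sub_distrib, ← Finset.sum_mul,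
      sum_occupancy_mul_policy hπstar, one_mul, inner_meanScore, Finset.mul_sum]
    congr 1
    exact Finset.sum_congr rfl fun s _ => Finset.sum_congr rfl fun a _ => by ring
  have hnpg : ‖npgDir M π θ‖ ^ 2 ≤ ‖gradient (objective M π) θ‖ ^ 2 / μ ^ 2 := by
    have h := norm_inv_mulVec_le hμ (hfisher θ hθ) (gradient (objective M π) θ)
    rw [le_div_iff₀ (by positivity), ← mul_pow, mul_comm]
    exact pow_le_pow_left₀ (by positivity) h 2
  have hw' := half_mul_norm_sq_le hΘ_open (fun x hx y hy => hG₂ x hx y hy s₀ a₀) hθ w hnpg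
  have hdiv : inner ℝ (meanScore M π πstar θ) w - α * (G₂ / 2 * ‖w‖ ^ 2) ≤
      (expectedKL M πstar (π θ) - expectedKL M πstar (π (θ + α • w))) / α := by
    rw [le_div_iff₀ hα]
    linarith
  have := mul_le_mul_of_nonneg_left hw' hα.le
  rw [hsplit] at herr
  rw [inner_sub_right]
  linarith

end Policy

/-! Dependence of the iterates on the trajectory -/

section Congr

variable {S A : Type*} [Fintype S] {d m : ℕ} {M : MDP S A} {π : Vec d → S → A → ℝ}
  {I : Input S d m} {x x' : ℕ → S} {y y' : ℕ → A}

/-- Transitions ending at time `n` read the state at `n` but not the action, hence `≤` for states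
and `<` for actions. -/
theorem criticIter_congr (t₀ : ℕ) (ξ : ℝ × Vec m) (h : ℕ)
    (hx : ∀ t ≤ t₀ + h * I.B, x t = x' t) (hy : ∀ t < t₀ + h * I.B, y t = y' t) :
    criticIter M I x y t₀ ξ h = criticIter M I x' y' t₀ ξ h := by
  induction h with
  | zero => rfl
  | succ h ih =>
    rw [Nat.succ_mul, ← add_assoc] at hx hy
    simp only [criticIter]
    rw [ih (fun t ht => hx t (by omega)) (fun t ht => hy t (by omega))]
    congr 3
    refine Finset.sum_congr rfl fun b hb => ?_
    rw [Finset.mem_range] at hb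
    rw [hx _ (by omega), hx _ (by omega), hy _ (by omega)]

theorem actorIter_congr (t₀ : ℕ) (θ : Vec d) (ξ : ℝ × Vec m) (w : Vec d) (h : ℕ)
    (hx : ∀ t ≤ t₀ + h * I.B, x t = x' t) (hy : ∀ t < t₀ + h * I.B, y t = y' t) :
    actorIter M π I x y t₀ θ ξ w h = actorIter M π I x' y' t₀ θ ξ w h := by
  induction h with
  | zero => rfl
  | succ h ih =>
    rw [Nat.succ_mul, ← add_assoc] at hx hy
    simp only [actorIter]
    rw [ih (fun t ht => hx t (by omega)) (fun t ht => hy t (by omega))]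
    congr 3
    refine Finset.sum_congr rfl fun b hb => ?_
    rw [Finset.mem_range] at hb
    rw [hx _ (by omega), hx _ (by omega), hy _ (by omega)]

theorem epochNPG_congr (k : ℕ) (θ : Vec d)
    (hx : ∀ t ≤ (k + 1) * (2 * I.H * I.B), x t = x' t)
    (hy : ∀ t < (k + 1) * (2 * I.H * I.B), y t = y' t) :
    epochNPG M π I x y k θ = epochNPG M π I x' y' k θ := by
  have h : (k + 1) * (2 * I.H * I.B) = k * (2 * I.H * I.B) + I.H * I.B + I.H * I.B := by ring
  rw [h] at hx hy
  unfold epochNPG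
  rw [criticIter_congr (x' := x') (y' := y') _ _ _ (fun t ht => hx t (by omega))
    (fun t ht => hy t (by omega)), actorIter_congr (x' := x') (y' := y') _ _ _ _ _ hx hy]

theorem policyParam_congr (k : ℕ)
    (hx : ∀ t ≤ k * (2 * I.H * I.B), x t = x' t) (hy : ∀ t < k * (2 * I.H * I.B), y t = y' t) :
    policyParam M π I x y k = policyParam M π I x' y' k := by
  induction k with
  | zero => rfl
  | succ k ih =>
    have hle : k * (2 * I.H * I.B) ≤ (k + 1) * (2 * I.H * I.B) :=
      Nat.mul_le_mul_right _ (Nat.le_succ k)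
    simp only [policyParam]
    rw [ih (fun t ht => hx t (by omega)) (fun t ht => hy t (by omega)), epochNPG_congr k _ hx hy]

theorem npgEst_congr (k : ℕ)
    (hx : ∀ t ≤ (k + 1) * (2 * I.H * I.B), x t = x' t)
    (hy : ∀ t < (k + 1) * (2 * I.H * I.B), y t = y' t) :
    npgEst M π I x y k = npgEst M π I x' y' k := by
  have hle : k * (2 * I.H * I.B) ≤ (k + 1) * (2 * I.H * I.B) :=
    Nat.mul_le_mul_right _ (Nat.le_succ k)
  unfold npgEst
  rw [policyParam_congr k (fun t ht => hx t (by omega)) (fun t ht => hy t (by omega)),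
    epochNPG_congr k _ hx hy]

end Congr

/-! Functions of a finite part of the trajectory -/

section Prefix

variable {S A Ω : Type*} {s : ℕ → Ω → S} {a : ℕ → Ω → A}

/-- `f` depends only on `s_0, a_0, …, s_{n-1}, a_{n-1}, s_n`. -/
def PrefixDet (s : ℕ → Ω → S) (a : ℕ → Ω → A) (n : ℕ) {β : Type*} (f : Ω → β) : Prop :=
  ∀ o o', (∀ t ≤ n, s t o = s t o') → (∀ t < n, a t o = a t o') → f o = f o'

theorem PrefixDet.mono {β : Type*} {f : Ω → β} {n n' : ℕ} (hf : PrefixDet s a n f)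
    (h : n ≤ n') : PrefixDet s a n' f := fun o o' hs ha =>
  hf o o' (fun t ht => hs t (ht.trans h)) (fun t ht => ha t (ht.trans_le h))

theorem PrefixDet.comp {β γ : Type*} {f : Ω → β} {n : ℕ} (hf : PrefixDet s a n f) (g : β → γ) :
    PrefixDet s a n fun o => g (f o) := fun o o' hs ha => congrArg g (hf o o' hs ha)

theorem PrefixDet.comp₂ {β γ δ : Type*} {f : Ω → β} {g : Ω → γ} {n : ℕ}
    (hf : PrefixDet s a n f) (hg : PrefixDet s a n g) (h : β → γ → δ) :
    PrefixDet s a n fun o => h (f o) (g o) := fun o o' hs ha => by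
  simp only [hf o o' hs ha, hg o o' hs ha]

theorem prefixDet_state {t n : ℕ} (h : t ≤ n) : PrefixDet s a n (s t) :=
  fun _ _ hs _ => hs t h

theorem prefixDet_action {t n : ℕ} (h : t < n) : PrefixDet s a n (a t) :=
  fun _ _ _ ha => ha t h

/-- The states and actions up to time `n`. -/
def pathPrefix (s : ℕ → Ω → S) (a : ℕ → Ω → A) (n : ℕ) (o : Ω) :
    (Fin (n + 1) → S) × (Fin n → A) := (fun i => s i o, fun i => a i o)

theorem pathPrefix_eq_iff {n : ℕ} {o o' : Ω} : pathPrefix s a n o = pathPrefix s a n o' ↔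
    (∀ t ≤ n, s t o = s t o') ∧ ∀ t < n, a t o = a t o' := by
  simp only [pathPrefix, Prod.mk.injEq, funext_iff, Fin.forall_iff, Nat.lt_succ_iff]

theorem PrefixDet.exists_eq_comp {β : Type*} [Nonempty β] {f : Ω → β} {n : ℕ}
    (hf : PrefixDet s a n f) : ∃ g, f = g ∘ pathPrefix s a n := by
  have h : f.FactorsThrough (pathPrefix s a n) := fun o o' hoo' =>
    hf o o' (pathPrefix_eq_iff.mp hoo').1 (pathPrefix_eq_iff.mp hoo').2
  exact ⟨Function.extend (pathPrefix s a n) f fun _ => Classical.arbitrary β,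
    (h.extend_comp _).symm⟩

theorem measurableSet_pathPrefix_preimage {mΩ : MeasurableSpace Ω} {n : ℕ}
    (hs : ∀ t ≤ n, ∀ x, MeasurableSet (s t ⁻¹' {x}))
    (ha : ∀ t < n, ∀ y, MeasurableSet (a t ⁻¹' {y})) (p : (Fin (n + 1) → S) × (Fin n → A)) :
    MeasurableSet (pathPrefix s a n ⁻¹' {p}) := by
  have h : pathPrefix s a n ⁻¹' {p} =
      (⋂ i : Fin (n + 1), s i.val ⁻¹' {p.1 i}) ∩ ⋂ i : Fin n, a i.val ⁻¹' {p.2 i} := by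
    ext o
    simp [pathPrefix, Prod.ext_iff, funext_iff]
  rw [h]
  exact (MeasurableSet.iInter fun i : Fin (n + 1) => hs i.val (Nat.lt_succ_iff.mp i.2) _).inter
    (MeasurableSet.iInter fun i : Fin n => ha i.val i.2 _)

theorem integral_eq_sum_prefix [MeasurableSpace Ω] {Pr : Measure Ω} [IsFiniteMeasure Pr]
    (hs : ∀ t x, MeasurableSet (s t ⁻¹' {x})) (ha : ∀ t y, MeasurableSet (a t ⁻¹' {y}))
    (n : ℕ) [Fintype ((Fin (n + 1) → S) × (Fin n → A))] {f : Ω → ℝ} (hf : Integrable f Pr) :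
    ∫ o, f o ∂Pr = ∑ p, ∫ o in pathPrefix s a n ⁻¹' {p}, f o ∂Pr := by
  rw [← integral_iUnion_fintype
    (fun p => measurableSet_pathPrefix_preimage (fun t _ => hs t) (fun t _ => ha t) p)
    (fun p q hpq => Disjoint.preimage _ (Set.disjoint_singleton.mpr hpq))
    (fun p => hf.integrableOn), ← Set.preimage_iUnion, Set.iUnion_of_singleton,
    Set.preimage_univ, setIntegral_univ]

variable [Finite S] [Finite A]

/-- The path prefix takes finitely many values, so any function of it is measurable. This covers
gradients and `npgDir`, about whose regularity in `θ` nothing need be known. The σ-algebra is left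
free so that it can be the ambient one or `history`. -/
theorem PrefixDet.stronglyMeasurable {mΩ : MeasurableSpace Ω} {n : ℕ}
    (hs : ∀ t ≤ n, ∀ x, MeasurableSet (s t ⁻¹' {x}))
    (ha : ∀ t < n, ∀ y, MeasurableSet (a t ⁻¹' {y})) {β : Type*} [Nonempty β]
    [TopologicalSpace β] {f : Ω → β} (hf : PrefixDet s a n f) : StronglyMeasurable f := by
  obtain ⟨g, rfl⟩ := hf.exists_eq_comp
  let _ : MeasurableSpace ((Fin (n + 1) → S) × (Fin n → A)) := ⊤
  have hg : StronglyMeasurable g := .of_discrete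
  exact hg.comp_measurable
    (measurable_to_countable' fun p => measurableSet_pathPrefix_preimage hs ha p)

theorem PrefixDet.stronglyMeasurable_history {n : ℕ} {β : Type*} [Nonempty β]
    [TopologicalSpace β] {f : Ω → β} (hf : PrefixDet s a n f) :
    StronglyMeasurable[history s a n] f := by
  refine PrefixDet.stronglyMeasurable (mΩ := history s a n) (fun t ht x => ?_)
    (fun t ht y => ?_) hf
  · have h : MeasurableSpace.comap (s t) ⊤ ≤ history s a n :=
      le_sup_of_le_left (le_iSup₂_of_le t ht le_rfl)
    exact h _ ⟨{x}, trivial, rfl⟩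
  · have h : MeasurableSpace.comap (a t) ⊤ ≤ history s a n :=
      le_sup_of_le_right (le_iSup₂_of_le t ht le_rfl)
    exact h _ ⟨{y}, trivial, rfl⟩

theorem history_le {mΩ : MeasurableSpace Ω} (hs : ∀ t x, MeasurableSet (s t ⁻¹' {x}))
    (ha : ∀ t y, MeasurableSet (a t ⁻¹' {y})) (n : ℕ) : history s a n ≤ mΩ := by
  refine sup_le (iSup₂_le fun t _ => ?_) (iSup₂_le fun t _ => ?_)
  · let _ : MeasurableSpace S := ⊤
    exact (measurable_to_countable' (hs t)).comap_le
  · let _ : MeasurableSpace A := ⊤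
    exact (measurable_to_countable' (ha t)).comap_le

theorem PrefixDet.integrable [MeasurableSpace Ω] {Pr : Measure Ω} [IsFiniteMeasure Pr] {n : ℕ}
    (hs : ∀ t x, MeasurableSet (s t ⁻¹' {x})) (ha : ∀ t y, MeasurableSet (a t ⁻¹' {y}))
    {E : Type*} [NormedAddCommGroup E] {f : Ω → E} (hf : PrefixDet s a n f) :
    Integrable f Pr := by
  have hm := hf.stronglyMeasurable (fun t _ => hs t) (fun t _ => ha t)
  obtain ⟨g, rfl⟩ := hf.exists_eq_comp
  obtain ⟨C, hC⟩ := (Set.finite_range fun p => ‖g p‖).bddAbove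
  exact Integrable.of_bound hm.aestronglyMeasurable C
    (Eventually.of_forall fun o => hC ⟨_, rfl⟩)

end Prefix

/-! ### The one-step law of a run -/

section Run

variable {S A Ω : Type*} [Fintype S] {d m : ℕ} {M : MDP S A} {π : Vec d → S → A → ℝ}
  {I : Input S d m} {K : ℕ} {s : ℕ → Ω → S} {a : ℕ → Ω → A}

theorem prefixDet_policyParam (k : ℕ) : PrefixDet s a (k * (2 * I.H * I.B))
    fun o => policyParam M π I (fun t => s t o) (fun t => a t o) k :=
  fun _ _ hs ha => policyParam_congr k hs ha

theorem prefixDet_npgEst (k : ℕ) : PrefixDet s a ((k + 1) * (2 * I.H * I.B))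
    fun o => npgEst M π I (fun t => s t o) (fun t => a t o) k :=
  fun _ _ hs ha => npgEst_congr k hs ha

variable [MeasurableSpace Ω] {Pr : Measure Ω}

/-- Compare the path laws of lengths `n` and `n + 1`: they differ by one factor, once the earlier
factors are known not to see the new action and state. -/
theorem IsRun.prob_step (hrun : IsRun M π I K Pr s a) {n : ℕ}
    (hn : n < K * (2 * I.H * I.B)) (o : Ω) (b : A) (x : S) :
    Pr.real (pathPrefix s a n ⁻¹' {pathPrefix s a n o} ∩ {o' | a n o' = b ∧ s (n + 1) o' = x}) =
      Pr.real (pathPrefix s a n ⁻¹' {pathPrefix s a n o}) *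
        (π (policyParam M π I (fun t => s t o) (fun t => a t o) (n / (2 * I.H * I.B)))
          (s n o) b * M.P (s n o) b x) := by
  classical
  have h1 := hrun.law n hn.le (fun t => s t o) (fun t => a t o)
  have h2 := hrun.law (n + 1) hn (Function.update (fun t => s t o) (n + 1) x)
    (Function.update (fun t => a t o) n b)
  have hx : ∀ t ≤ n, Function.update (fun t => s t o) (n + 1) x t = s t o := fun t ht =>
    Function.update_of_ne (by omega) _ _
  have hy : ∀ t < n, Function.update (fun t => a t o) n b t = a t o := fun t ht =>
    Function.update_of_ne (by omega) _ _
  have hset1 : pathPrefix s a n ⁻¹' {pathPrefix s a n o} =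
      {o' | (∀ t ≤ n, s t o' = s t o) ∧ ∀ t < n, a t o' = a t o} := by
    ext o'
    exact pathPrefix_eq_iff
  have hset2 : {o' | (∀ t ≤ n, s t o' = s t o) ∧ ∀ t < n, a t o' = a t o} ∩
      {o' | a n o' = b ∧ s (n + 1) o' = x} =
      {o' | (∀ t ≤ n + 1, s t o' = Function.update (fun t => s t o) (n + 1) x t) ∧
        ∀ t < n + 1, a t o' = Function.update (fun t => a t o) n b t} := by
    ext o'
    simp only [Set.mem_inter_iff, Set.mem_ofPred_eq]
    constructor
    · rintro ⟨⟨hs, ha⟩, hb, hx'⟩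
      refine ⟨fun t ht => ?_, fun t ht => ?_⟩
      · rcases Nat.le_succ_iff.mp ht with h | rfl
        · rw [hx t h, hs t h]
        · simpa using hx'
      · rcases Nat.lt_succ_iff_lt_or_eq.mp ht with h | rfl
        · rw [hy t h, ha t h]
        · simpa using hb
    · rintro ⟨hs, ha⟩
      refine ⟨⟨fun t ht => ?_, fun t ht => ?_⟩, ?_, ?_⟩
      · rw [hs t (by omega), hx t ht]
      · rw [ha t (by omega), hy t ht]
      · simpa using ha n (by omega)
      · simpa using hs (n + 1) le_rfl
  -- The parameter in force at time `t` was fixed at the start of its epoch, at or before `t`, so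
  -- the altered entries are invisible to it.
  have hpol : ∀ t ≤ n, policyParam M π I (Function.update (fun t => s t o) (n + 1) x)
      (Function.update (fun t => a t o) n b) (t / (2 * I.H * I.B)) =
      policyParam M π I (fun t => s t o) (fun t => a t o) (t / (2 * I.H * I.B)) := by
    intro t ht
    have hle := Nat.div_mul_le_self t (2 * I.H * I.B)
    exact policyParam_congr _ (fun u hu => hx u (by omega)) (fun u hu => hy u (by omega))
  rw [hset1, hset2, h1, h2, Finset.prod_range_succ, hx 0 (Nat.zero_le n), hx n le_rfl,
    hpol n le_rfl, Function.update_self, Function.update_self, ← mul_assoc]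
  congr 2
  refine Finset.prod_congr rfl fun t ht => ?_
  rw [Finset.mem_range] at ht
  rw [hx t ht.le, hx (t + 1) ht, hy t ht, hpol t ht.le]

variable [Fintype A] [IsProbabilityMeasure Pr]

/-- The conditional law of the next action and state. -/
theorem IsRun.integral_step (hrun : IsRun M π I K Pr s a) {n : ℕ}
    (hn : n < K * (2 * I.H * I.B)) {G : Ω → A → S → ℝ} (hG : PrefixDet s a n G) :
    ∫ o, G o (a n o) (s (n + 1) o) ∂Pr = ∫ o, ∑ b, ∑ x,
      π (policyParam M π I (fun t => s t o) (fun t => a t o) (n / (2 * I.H * I.B))) (s n o) b *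
        M.P (s n o) b x * G o b x ∂Pr := by
  classical
  have hms := hrun.meas_state
  have hma := hrun.meas_action
  have hpol : PrefixDet s a n fun o =>
      policyParam M π I (fun t => s t o) (fun t => a t o) (n / (2 * I.H * I.B)) :=
    (prefixDet_policyParam _).mono (Nat.div_mul_le_self _ _)
  have hleft : PrefixDet s a (n + 1) fun o => G o (a n o) (s (n + 1) o) := fun o o' hs ha => by
    simp only [(hG.mono n.le_succ) o o' hs ha, hs (n + 1) le_rfl, ha n n.lt_succ_self]
  have hright : PrefixDet s a n fun o => ∑ b, ∑ x,
      π (policyParam M π I (fun t => s t o) (fun t => a t o) (n / (2 * I.H * I.B))) (s n o) b *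
        M.P (s n o) b x * G o b x := fun o o' hs ha => by
    have h := hpol o o' hs ha
    simp only at h
    simp only [hG o o' hs ha, hs n le_rfl, h]
  rw [integral_eq_sum_prefix hms hma n (hleft.integrable hms hma),
    integral_eq_sum_prefix hms hma n (hright.integrable hms hma)]
  refine Finset.sum_congr rfl fun p _ => ?_
  -- On a nonempty cylinder, a representative `o` freezes `G`, the state and the policy; only the
  -- next action and state remain random.
  by_cases hp : ∃ o, pathPrefix s a n o = p
  · obtain ⟨o, rfl⟩ := hp
    have hC := measurableSet_pathPrefix_preimage (fun t _ => hms t) (fun t _ => hma t)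
      (pathPrefix s a n o)
    set C := pathPrefix s a n ⁻¹' {pathPrefix s a n o}
    have hagree : ∀ o' ∈ C, (∀ t ≤ n, s t o' = s t o) ∧ ∀ t < n, a t o' = a t o :=
      fun o' ho' => pathPrefix_eq_iff.mp ho'
    rw [setIntegral_congr_fun hC (fun o' ho' => hright o' o (hagree o' ho').1 (hagree o' ho').2),
      setIntegral_const]
    have hE : ∀ b x, MeasurableSet {o' | a n o' = b ∧ s (n + 1) o' = x} := fun b x =>
      (hma n b).inter (hms (n + 1) x)
    have hdec : Set.EqOn (fun o' => G o' (a n o') (s (n + 1) o'))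
        (fun o' => ∑ b, ∑ x, {o' | a n o' = b ∧ s (n + 1) o' = x}.indicator
          (fun _ => G o b x) o') C := by
      intro o' ho'
      have hGo := hG o' o (hagree o' ho').1 (hagree o' ho').2
      simp only [hGo, Set.indicator_apply, Set.mem_ofPred_eq, ite_and]
      rw [Finset.sum_eq_single (a n o')]
      · simp
      · intro b _ hb
        simp [hb.symm]
      · simp
    rw [setIntegral_congr_fun hC hdec, integral_finsetSum _ fun b _ =>
      integrable_finsetSum _ fun x _ => (integrable_const _).indicator (hE b x)]
    simp only [smul_eq_mul, Finset.mul_sum]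
    refine Finset.sum_congr rfl fun b _ => ?_
    rw [integral_finsetSum _ fun x _ => (integrable_const _).indicator (hE b x)]
    refine Finset.sum_congr rfl fun x _ => ?_
    rw [integral_indicator_const _ (hE b x), measureReal_restrict_apply (hE b x), Set.inter_comm,
      hrun.prob_step hn, smul_eq_mul]
    ring
  · have hempty : pathPrefix s a n ⁻¹' {p} = ∅ := by
      ext o
      simpa using fun h => hp ⟨o, h⟩
    simp [hempty]

end Run

/-! ### Conditional expectation of inner products -/

section CondExp

variable {Ω E : Type*} {m m₀ : MeasurableSpace Ω} {P : Measure Ω} [NormedAddCommGroup E]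
  [InnerProductSpace ℝ E] [CompleteSpace E] {u w : Ω → E}

theorem condExp_inner_of_stronglyMeasurable_left (hu : StronglyMeasurable[m] u)
    (huw : Integrable (fun o => inner ℝ (u o) (w o)) P) (hw : Integrable w P) :
    P[fun o => inner ℝ (u o) (w o) | m] =ᵐ[P] fun o => inner ℝ (u o) ((P[w | m]) o) :=
  condExp_bilin_of_stronglyMeasurable_left (innerSL ℝ : E →L[ℝ] E →L[ℝ] ℝ) hu huw hw

theorem integral_inner_condExp [IsFiniteMeasure P] (hm : m ≤ m₀) (hu : StronglyMeasurable[m] u)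
    (huw : Integrable (fun o => inner ℝ (u o) (w o)) P) (hw : Integrable w P) :
    ∫ o, inner ℝ (u o) (w o) ∂P = ∫ o, inner ℝ (u o) ((P[w | m]) o) ∂P := by
  rw [← integral_condExp hm]
  exact integral_congr_ae (condExp_inner_of_stronglyMeasurable_left hu huw hw)

end CondExp

theorem sum_range_mul_eq (f : ℕ → ℝ) (K N : ℕ) :
    ∑ t ∈ Finset.range (K * N), f t =
      ∑ k ∈ Finset.range K, ∑ j ∈ Finset.range N, f (k * N + j) := by
  induction K with
  | zero => simp
  | succ K ih => rw [Nat.succ_mul, Finset.sum_range_add, ih, Finset.sum_range_succ]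

/-! ### Regret along a run -/

section Run

variable {S A Ω : Type*} [Fintype S] [DecidableEq S] [Fintype A] {d m : ℕ}
  {M : MDP S A} {π : Vec d → S → A → ℝ} {Θ : Set (Vec d)}
  {I : Input S d m} {K : ℕ} {s : ℕ → Ω → S} {a : ℕ → Ω → A}
  [MeasurableSpace Ω] {Pr : Measure Ω} [IsProbabilityMeasure Pr]
  {θ ω : ℕ → Ω → Vec d}

/-- Within an epoch, the average reward exceeds the collected rewards by a telescoping sum of
values. -/
theorem IsRun.integral_epoch_eq (hrun : IsRun M π I K Pr s a)
    (hπ : ∀ θ ∈ Θ, IsPolicy (π θ)) (hunichain : ∀ θ ∈ Θ, IsUnichain (transition M (π θ)))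
    (hθ : ∀ k o, θ k o = policyParam M π I (fun t => s t o) (fun t => a t o) k)
    (hθ_mem : ∀ᵐ o ∂Pr, ∀ k ≤ K, θ k o ∈ Θ) {k : ℕ} (hk : k < K) {n : ℕ}
    (hn : n ≤ 2 * I.H * I.B) :
    ∫ o, ∑ j ∈ Finset.range n,
      (objective M π (θ k o) - M.r (s (k * (2 * I.H * I.B) + j) o)
        (a (k * (2 * I.H * I.B) + j) o)) ∂Pr =
    ∫ o, (vValue M (π (θ k o)) (s (k * (2 * I.H * I.B) + n) o)
      - vValue M (π (θ k o)) (s (k * (2 * I.H * I.B)) o)) ∂Pr := by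
  obtain rfl : θ = fun k o => policyParam M π I (fun t => s t o) (fun t => a t o) k :=
    funext fun k => funext fun o => hθ k o
  set N := 2 * I.H * I.B with hN
  have hms := hrun.meas_state
  have hma := hrun.meas_action
  have hθk : PrefixDet s a (k * N)
      fun o => policyParam M π I (fun t => s t o) (fun t => a t o) k := prefixDet_policyParam k
  have hval : ∀ j, PrefixDet s a (k * N + j) fun o =>
      vValue M (π (policyParam M π I (fun t => s t o) (fun t => a t o) k)) (s (k * N + j) o) :=
    fun j => (hθk.mono (Nat.le_add_right _ _)).comp₂ (prefixDet_state le_rfl)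
      fun θ x => vValue M (π θ) x
  have hrew : ∀ j, PrefixDet s a (k * N + (j + 1)) fun o =>
      objective M π (policyParam M π I (fun t => s t o) (fun t => a t o) k)
        - M.r (s (k * N + j) o) (a (k * N + j) o) := fun j =>
    ((hθk.comp (objective M π)).mono (Nat.le_add_right _ _)).comp₂
      ((prefixDet_state (by omega)).comp₂ (prefixDet_action (by omega)) M.r) (· - ·)
  induction n with
  | zero => simp
  | succ n ih =>
    have hlt : k * N + n < K * N := by
      calc k * N + n < (k + 1) * N := by rw [Nat.succ_mul]; omega
        _ ≤ K * N := Nat.mul_le_mul_right _ hk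
    have hdiv : (k * N + n) / N = k := by
      rw [mul_comm, Nat.mul_add_div (by omega), Nat.div_eq_of_lt (by omega), add_zero]
    -- The one-step increment of values minus the reward gap; its conditional mean is zero by the
    -- Poisson equation whenever the current parameter lies in `Θ`.
    let G : Ω → A → S → ℝ := fun o b x =>
      vValue M (π (policyParam M π I (fun t => s t o) (fun t => a t o) k)) x
        - vValue M (π (policyParam M π I (fun t => s t o) (fun t => a t o) k)) (s (k * N + n) o)
        - (objective M π (policyParam M π I (fun t => s t o) (fun t => a t o) k)
          - M.r (s (k * N + n) o) b)
    have hG : PrefixDet s a (k * N + n) G :=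
      (hθk.mono (Nat.le_add_right _ _)).comp₂ (prefixDet_state le_rfl) fun θ y b x =>
        vValue M (π θ) x - vValue M (π θ) y - (objective M π θ - M.r y b)
    have hstep := hrun.integral_step hlt hG
    have hzero : (∫ o, ∑ b, ∑ x, π (policyParam M π I (fun t => s t o) (fun t => a t o)
        ((k * N + n) / (2 * I.H * I.B))) (s (k * N + n) o) b *
        M.P (s (k * N + n) o) b x * G o b x ∂Pr) = 0 := by
      refine integral_eq_zero_of_ae ?_
      filter_upwards [hθ_mem] with o ho
      have hmem := ho k hk.le
      rw [← hN, hdiv]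
      simp only [G, Pi.zero_apply]
      set ϑ := policyParam M π I (fun t => s t o) (fun t => a t o) k
      set y := s (k * N + n) o
      have hV := vValue_eq (M := M) (hπ ϑ hmem) (hunichain ϑ hmem) y
      rw [sum_transition_mul, show avgReward M (π ϑ) = objective M π ϑ from rfl] at hV
      have hinner : ∀ b, ∑ x, π ϑ y b * M.P y b x *
          (vValue M (π ϑ) x - vValue M (π ϑ) y - (objective M π ϑ - M.r y b)) =
          π ϑ y b * ∑ x, M.P y b x * vValue M (π ϑ) x
            - π ϑ y b * (vValue M (π ϑ) y + objective M π ϑ) + π ϑ y b * M.r y b := by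
        intro b
        simp only [mul_assoc, ← Finset.mul_sum]
        simp only [mul_sub, Finset.sum_sub_distrib, ← Finset.sum_mul, M.P_sum, one_mul]
        ring
      simp only [hinner, Finset.sum_add_distrib, Finset.sum_sub_distrib, ← Finset.sum_mul,
        (hπ ϑ hmem).2, one_mul]
      linarith
    rw [hzero] at hstep
    simp only [G] at hstep
    have i0 := (hval 0).integrable (Pr := Pr) hms hma
    rw [add_zero] at i0
    have i1 := (hval n).integrable (Pr := Pr) hms hma
    have i2 := (hval (n + 1)).integrable (Pr := Pr) hms hma
    have i3 := fun j => (hrew j).integrable (Pr := Pr) hms hma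
    have ih' := ih (by omega)
    simp only [Finset.sum_range_succ]
    rw [integral_add (integrable_finsetSum _ fun j _ => i3 j) (i3 n), ih']
    rw [integral_sub i1 i0, integral_sub i2 i0]
    have h4 := integral_sub (i2.sub i1) (i3 n)
    simp only [Pi.sub_apply] at h4
    rw [integral_sub i2 i1] at h4
    have h5 := h4.symm.trans hstep
    linarith

/-- With one policy per epoch, value functions of different policies are never compared: each epoch
pays one span, `2C`. -/
theorem IsRun.integral_epoch_le (hrun : IsRun M π I K Pr s a)
    (hπ : ∀ θ ∈ Θ, IsPolicy (π θ)) (hunichain : ∀ θ ∈ Θ, IsUnichain (transition M (π θ)))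
    (hθ : ∀ k o, θ k o = policyParam M π I (fun t => s t o) (fun t => a t o) k)
    (hθ_mem : ∀ᵐ o ∂Pr, ∀ k ≤ K, θ k o ∈ Θ) (hC : cTotal M π Θ ≠ ⊤) {k : ℕ} (hk : k < K) :
    ∫ o, ∑ j ∈ Finset.range (2 * I.H * I.B),
      (objective M π (θ k o) - M.r (s (k * (2 * I.H * I.B) + j) o)
        (a (k * (2 * I.H * I.B) + j) o)) ∂Pr ≤ 2 * (cTotal M π Θ).toReal := by
  rw [hrun.integral_epoch_eq hπ hunichain hθ hθ_mem hk le_rfl]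
  obtain rfl : θ = fun k o => policyParam M π I (fun t => s t o) (fun t => a t o) k :=
    funext fun k => funext fun o => hθ k o
  have hθk : PrefixDet s a (k * (2 * I.H * I.B))
      fun o => policyParam M π I (fun t => s t o) (fun t => a t o) k := prefixDet_policyParam k
  have hval : ∀ j, Integrable (fun o =>
      vValue M (π (policyParam M π I (fun t => s t o) (fun t => a t o) k))
        (s (k * (2 * I.H * I.B) + j) o)) Pr :=
    fun j => ((hθk.mono (Nat.le_add_right _ _)).comp₂ (prefixDet_state le_rfl)
      fun θ x => vValue M (π θ) x).integrable hrun.meas_state hrun.meas_action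
  refine (integral_mono_ae ((hval _).sub (hval 0))
    (integrable_const (2 * (cTotal M π Θ).toReal)) ?_).trans (by simp)
  filter_upwards [hθ_mem] with o ho
  have hmem := ho k hk.le
  refine vValue_sub_le (hπ _ hmem) (hunichain _ hmem) ?_ ENNReal.toReal_nonneg _ _
  rw [ENNReal.ofReal_toReal hC]
  exact add_le_add (le_iSup₂ (f := fun θ (_ : θ ∈ Θ) => cHit M (π θ)) _ hmem)
    (le_iSup₂ (f := fun θ (_ : θ ∈ Θ) => cTar M (π θ)) _ hmem)

/-- The expected regret bound with finite constants. -/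
theorem IsRun.integral_regret_le
    (hΘ_open : IsOpen Θ) (hΘ_convex : Convex ℝ Θ)
    (hπ : ∀ θ ∈ Θ, IsPolicy (π θ)) (hπ_pos : ∀ θ ∈ Θ, ∀ s a, 0 < π θ s a)
    (hπ_diff : ∀ θ ∈ Θ, ∀ s a, DifferentiableAt ℝ (fun θ' => Real.log (π θ' s a)) θ)
    (hunichain : ∀ θ ∈ Θ, IsUnichain (transition M (π θ)))
    {G₁ G₂ : ℝ} (hG₁ : ∀ θ ∈ Θ, ∀ s a, ‖score π θ s a‖ ≤ G₁)
    (hG₂ : ∀ θ₁ ∈ Θ, ∀ θ₂ ∈ Θ, ∀ s a, ‖score π θ₁ s a - score π θ₂ s a‖ ≤ G₂ * ‖θ₁ - θ₂‖)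
    {μ : ℝ} (hμ : 0 < μ)
    (hfisher : ∀ θ ∈ Θ, (fisher M π θ - μ • (1 : Matrix (Fin d) (Fin d) ℝ)).PosSemidef)
    {πstar : S → A → ℝ} (hπstar : IsPolicy πstar)
    (hπstar_opt : ∀ θ ∈ Θ, objective M π θ ≤ avgReward M πstar)
    (hα : 0 < I.α) (hrun : IsRun M π I K Pr s a)
    (hθ : ∀ k o, θ k o = policyParam M π I (fun t => s t o) (fun t => a t o) k)
    (hω : ∀ k o, ω k o = npgEst M π I (fun t => s t o) (fun t => a t o) k)
    (hθ_mem : ∀ᵐ o ∂Pr, ∀ k ≤ K, θ k o ∈ Θ)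
    (hε : epsBias M π Θ πstar ≠ ⊤) (hC : cTotal M π Θ ≠ ⊤) :
    ∫ o, ∑ t ∈ Finset.range (K * (2 * I.H * I.B)),
        (optValue M π Θ - M.r (s t o) (a t o)) ∂Pr ≤
      (2 * I.H * I.B : ℝ) * (K * Real.sqrt (2 * (epsBias M π Θ πstar).toReal)
        + G₁ * ∑ k ∈ Finset.range K,
          ∫ o, ‖(Pr[ω k | history s a (k * (2 * I.H * I.B))]) o - npgDir M π (θ k o)‖ ∂Pr
        + expectedKL M πstar (π I.θ₀) / I.α
        + I.α * G₂ * ∑ k ∈ Finset.range K,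
          (∫ o, ‖ω k o - npgDir M π (θ k o)‖ ^ 2 ∂Pr
            + (∫ o, ‖gradient (objective M π) (θ k o)‖ ^ 2 ∂Pr) / μ ^ 2))
      + 2 * (cTotal M π Θ).toReal * K := by
  have hms := hrun.meas_state
  have hma := hrun.meas_action
  set N := 2 * I.H * I.B with hN
  have hstepθ : ∀ k o, θ (k + 1) o = θ k o + I.α • ω k o := by
    intro k o
    rw [hθ, hθ, hω]
    rfl
  have hθ0 : ∀ o, θ 0 o = I.θ₀ := fun o => hθ 0 o
  have hθdet : ∀ k, PrefixDet s a (k * N) (θ k) := by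
    intro k
    rw [funext (hθ k)]
    exact prefixDet_policyParam k
  have hωdet : ∀ k, PrefixDet s a ((k + 1) * N) (ω k) := by
    intro k
    rw [funext (hω k)]
    exact prefixDet_npgEst k
  have hmono : ∀ k, k * N ≤ (k + 1) * N := fun k => Nat.mul_le_mul_right _ k.le_succ
  have hθint : ∀ {E : Type} [NormedAddCommGroup E] (f : Vec d → E) k,
      Integrable (fun o => f (θ k o)) Pr := fun f k =>
    ((hθdet k).comp f).integrable hms hma
  have hθωint : ∀ (f : Vec d → Vec d → ℝ) k, Integrable (fun o => f (θ k o) (ω k o)) Pr :=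
    fun f k => (((hθdet k).mono (hmono k)).comp₂ (hωdet k) f).integrable hms hma
  have hopt : optValue M π Θ ≤ avgReward M πstar := by
    -- The supremum bound needs `Θ` nonempty; an outcome of the run supplies a point.
    obtain ⟨o, ho⟩ := hθ_mem.exists
    refine csSup_le ⟨_, ⟨_, ho 0 K.zero_le, rfl⟩⟩ ?_
    rintro _ ⟨ϑ, hϑ, rfl⟩
    exact hπstar_opt ϑ hϑ
  have hrint : ∀ t, Integrable (fun o => M.r (s t o) (a t o)) Pr := fun t =>
    ((prefixDet_state t.le_succ).comp₂ (prefixDet_action t.lt_succ_self) M.r).integrable hms hma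
  -- `meanScore` and `npgDir` at `θ k` are known at the start of the epoch, so `ω k` is replaced by
  -- its conditional mean before norms are taken.
  have hinner : ∀ k < K, ∫ o, inner ℝ (meanScore M π πstar (θ k o))
        (npgDir M π (θ k o) - ω k o) ∂Pr ≤
      G₁ * ∫ o, ‖(Pr[ω k | history s a (k * N)]) o - npgDir M π (θ k o)‖ ∂Pr := by
    intro k hk
    have hωint : Integrable (ω k) Pr := (hωdet k).integrable hms hma
    have hm := history_le hms hma (k * N)
    have hu : StronglyMeasurable[history s a (k * N)] fun o => meanScore M π πstar (θ k o) :=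
      ((hθdet k).comp _).stronglyMeasurable_history
    have hv : StronglyMeasurable[history s a (k * N)] fun o => npgDir M π (θ k o) :=
      ((hθdet k).comp _).stronglyMeasurable_history
    have hvint : Integrable (fun o => npgDir M π (θ k o)) Pr := hθint _ k
    have hcond : (Pr[fun o => npgDir M π (θ k o) - ω k o | history s a (k * N)]) =ᵐ[Pr]
        fun o => npgDir M π (θ k o) - (Pr[ω k | history s a (k * N)]) o := by
      have h := condExp_sub hvint hωint (history s a (k * N))
      rw [condExp_of_stronglyMeasurable hm hv hvint] at h
      exact h
    have huw := hθωint (fun ϑ w => inner ℝ (meanScore M π πstar ϑ) (npgDir M π ϑ - w)) k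
    rw [integral_inner_condExp hm hu huw (hvint.sub hωint), ← integral_const_mul]
    refine integral_mono_ae (integrable_condExp.congr
      (condExp_inner_of_stronglyMeasurable_left hu huw (hvint.sub hωint)))
      ((integrable_condExp.sub hvint).norm.const_mul G₁) ?_
    filter_upwards [hθ_mem, hcond] with o ho hc
    rw [hc, norm_sub_rev]
    exact (real_inner_le_norm _ _).trans (mul_le_mul_of_nonneg_right
      (norm_meanScore_le hπstar (hG₁ _ (ho k hk.le))) (norm_nonneg _))
  have hsub : ∀ k < K, ∫ o, (avgReward M πstar - objective M π (θ k o)) ∂Pr ≤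
      Real.sqrt (2 * (epsBias M π Θ πstar).toReal)
      + G₁ * ∫ o, ‖(Pr[ω k | history s a (k * N)]) o - npgDir M π (θ k o)‖ ∂Pr
      + (∫ o, expectedKL M πstar (π (θ k o)) ∂Pr
        - ∫ o, expectedKL M πstar (π (θ (k + 1) o)) ∂Pr) / I.α
      + I.α * G₂ * (∫ o, ‖ω k o - npgDir M π (θ k o)‖ ^ 2 ∂Pr
          + (∫ o, ‖gradient (objective M π) (θ k o)‖ ^ 2 ∂Pr) / μ ^ 2) := by
    intro k hk
    have i1 := hθωint (fun ϑ w => inner ℝ (meanScore M π πstar ϑ) (npgDir M π ϑ - w)) k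
    have i2 := hθint (fun ϑ => expectedKL M πstar (π ϑ))
    have i3 := hθωint (fun ϑ w => ‖w - npgDir M π ϑ‖ ^ 2) k
    have i4 := hθint (fun ϑ => ‖gradient (objective M π) ϑ‖ ^ 2) k
    have i5 := hθint (fun ϑ => avgReward M πstar - objective M π ϑ) k
    have h := integral_mono_ae i5 ((((integrable_const
      (Real.sqrt (2 * (epsBias M π Θ πstar).toReal))).add i1).add
        (((i2 k).sub (i2 (k + 1))).div_const I.α)).add
        ((i3.add (i4.div_const (μ ^ 2))).const_mul (I.α * G₂))) (by
      filter_upwards [hθ_mem] with o ho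
      have h1 := ho k hk.le
      have h2 := ho (k + 1) hk
      rw [hstepθ] at h2
      have := suboptimality_le hΘ_open hΘ_convex hπ hπ_pos hπ_diff hunichain hG₂ hμ hfisher
        hπstar hε hα h1 h2
      simpa only [Pi.add_apply, Pi.sub_apply, hstepθ] using this)
    refine h.trans ?_
    rw [integral_add' (((integrable_const _).add i1).add
        (((i2 k).sub (i2 (k + 1))).div_const I.α))
        ((i3.add (i4.div_const (μ ^ 2))).const_mul (I.α * G₂)),
      integral_add' ((integrable_const _).add i1) (((i2 k).sub (i2 (k + 1))).div_const I.α),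
      integral_add' (integrable_const _) i1, integral_const_mul, integral_div,
      integral_sub' (i2 k) (i2 (k + 1)), integral_add' i3 (i4.div_const (μ ^ 2)), integral_div,
      integral_const, probReal_univ, one_smul]
    have := hinner k hk
    linarith
  have hepoch : ∀ k < K, ∫ o, ∑ j ∈ Finset.range N,
        (optValue M π Θ - M.r (s (k * N + j) o) (a (k * N + j) o)) ∂Pr ≤
      N * ∫ o, (avgReward M πstar - objective M π (θ k o)) ∂Pr
        + 2 * (cTotal M π Θ).toReal := by
    intro k hk
    have h1 := hrun.integral_epoch_le hπ hunichain hθ hθ_mem hC hk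
    have i5 := hθint (fun ϑ => avgReward M πstar - objective M π ϑ) k
    have i6 : Integrable (fun o => ∑ j ∈ Finset.range N,
        (objective M π (θ k o) - M.r (s (k * N + j) o) (a (k * N + j) o))) Pr :=
      integrable_finsetSum _ fun j _ => (hθint (objective M π) k).sub (hrint (k * N + j))
    have h2 := integral_mono (μ := Pr)
      (integrable_finsetSum (Finset.range N) fun j _ =>
        (integrable_const (optValue M π Θ)).sub (hrint (k * N + j)))
      ((i5.const_mul (N : ℝ)).add i6) (fun o => by
        simp only [Pi.add_apply, Pi.sub_apply, Finset.sum_sub_distrib, Finset.sum_const,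
          Finset.card_range, nsmul_eq_mul]
        have := mul_le_mul_of_nonneg_left hopt (Nat.cast_nonneg (α := ℝ) N)
        linarith)
    rw [integral_add' (i5.const_mul (N : ℝ)) i6, integral_const_mul] at h2
    simp only [Pi.sub_apply] at h2
    linarith
  simp only [sum_range_mul_eq]
  have hregret : ∀ t, Integrable (fun o => optValue M π Θ - M.r (s t o) (a t o)) Pr := fun t =>
    (integrable_const _).sub (hrint t)
  rw [integral_finsetSum _ fun k _ => integrable_finsetSum _ fun j _ => hregret (k * N + j)]
  have hKL : 0 ≤ ∫ o, expectedKL M πstar (π (θ K o)) ∂Pr := by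
    refine integral_nonneg_of_ae ?_
    filter_upwards [hθ_mem] with o ho
    exact expectedKL_nonneg hπstar (hπ _ (ho K le_rfl)) (hπ_pos _ (ho K le_rfl))
  have hKL0 : ∫ o, expectedKL M πstar (π (θ 0 o)) ∂Pr = expectedKL M πstar (π I.θ₀) := by
    simp [hθ0]
  have htel := Finset.sum_range_sub' (fun k => ∫ o, expectedKL M πstar (π (θ k o)) ∂Pr) K
  have hNc : ((N : ℕ) : ℝ) = 2 * I.H * I.B := by rw [hN]; push_cast; ring
  refine (Finset.sum_le_sum fun k hk => (hepoch k (Finset.mem_range.mp hk)).trans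
    (add_le_add_left (mul_le_mul_of_nonneg_left (hsub k (Finset.mem_range.mp hk))
      N.cast_nonneg) _)).trans ?_
  rw [Finset.sum_add_distrib, ← Finset.mul_sum, Finset.sum_add_distrib, Finset.sum_add_distrib,
    Finset.sum_add_distrib, ← Finset.sum_div, htel, hKL0, ← Finset.mul_sum, ← Finset.mul_sum,
    hNc]
  simp only [Finset.sum_const, Finset.card_range, nsmul_eq_mul]
  have h0 : (expectedKL M πstar (π I.θ₀) - ∫ o, expectedKL M πstar (π (θ K o)) ∂Pr) / I.α ≤
      expectedKL M πstar (π I.θ₀) / I.α := by gcongr; linarith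
  have := mul_le_mul_of_nonneg_left h0 (by positivity : (0 : ℝ) ≤ 2 * I.H * I.B)
  linarith

end Run

end NACB

end

/-! ### The bound with constants in `[0, ∞]` -/

open NACB
theorem lemma1 {S A : Type*} [Fintype S] [DecidableEq S] [Fintype A] {d m : ℕ}
    (M : MDP S A) (π : Vec d → S → A → ℝ) (Θ : Set (Vec d))
    -- the parametrized policy class
    (hΘ_open : IsOpen Θ) (hΘ_convex : Convex ℝ Θ)
    (hπ : ∀ θ ∈ Θ, IsPolicy (π θ)) (hπ_pos : ∀ θ ∈ Θ, ∀ s a, 0 < π θ s a)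
    (hπ_diff : ∀ θ ∈ Θ, ∀ s a, DifferentiableAt ℝ (fun θ' => Real.log (π θ' s a)) θ)
    (hunichain : ∀ θ ∈ Θ, IsUnichain (transition M (π θ)))
    -- bounded and Lipschitz score functions
    (G₁ G₂ : ℝ) (hG₁ : ∀ θ ∈ Θ, ∀ s a, ‖score π θ s a‖ ≤ G₁)
    (hG₂ : ∀ θ₁ ∈ Θ, ∀ θ₂ ∈ Θ, ∀ s a, ‖score π θ₁ s a - score π θ₂ s a‖ ≤ G₂ * ‖θ₁ - θ₂‖)
    -- Fisher non-degeneracy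
    (μ : ℝ) (hμ : 0 < μ)
    (hfisher : ∀ θ ∈ Θ, (fisher M π θ - μ • (1 : Matrix (Fin d) (Fin d) ℝ)).PosSemidef)
    -- smoothness of the objective
    (L : ℝ) (hJ_diff : DifferentiableOn ℝ (objective M π) Θ)
    (hJ_smooth : ∀ θ₁ ∈ Θ, ∀ θ₂ ∈ Θ,
      ‖gradient (objective M π) θ₁ - gradient (objective M π) θ₂‖ ≤ L * ‖θ₁ - θ₂‖)
    -- the optimal policy
    (πstar : S → A → ℝ) (hπstar : IsPolicy πstar)
    (hπstar_opt : ∀ θ ∈ Θ, objective M π θ ≤ avgReward M πstar)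
    -- a run of the algorithm
    (I : Input S d m) (hα : 0 < I.α) (K : ℕ)
    {Ω : Type*} [MeasurableSpace Ω] (Pr : Measure Ω) [IsProbabilityMeasure Pr]
    (s : ℕ → Ω → S) (a : ℕ → Ω → A) (hrun : IsRun M π I K Pr s a)
    (θ ω : ℕ → Ω → Vec d)
    (hθ : ∀ k o, θ k o = policyParam M π I (fun t => s t o) (fun t => a t o) k)
    (hω : ∀ k o, ω k o = npgEst M π I (fun t => s t o) (fun t => a t o) k)
    (hθ_mem : ∀ᵐ o ∂Pr, ∀ k ≤ K, θ k o ∈ Θ)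
    (T : ℕ) (hT : T = 2 * K * I.H * I.B) :
    ((∫ o, ∑ t ∈ Finset.range T, (optValue M π Θ - M.r (s t o) (a t o)) ∂Pr : ℝ) : EReal) ≤
      (((T : ℝ≥0∞) * (2 * epsBias M π Θ πstar) ^ (1 / 2 : ℝ) : ℝ≥0∞) : EReal)
      + ((2 * I.H * I.B * G₁ * ∑ k ∈ Finset.range K,
            ∫ o, ‖(Pr[ω k | history s a (k * (2 * I.H * I.B))]) o - npgDir M π (θ k o)‖ ∂Pr
          + 2 * I.α * G₂ * I.H * I.B * ∑ k ∈ Finset.range K,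
            ∫ o, ‖ω k o - npgDir M π (θ k o)‖ ^ 2 ∂Pr
          + 2 * I.α * G₂ * I.H * I.B / μ ^ 2 * ∑ k ∈ Finset.range K,
            ∫ o, ‖gradient (objective M π) (θ k o)‖ ^ 2 ∂Pr
          + 2 * I.H * I.B / I.α * expectedKL M πstar (π I.θ₀) : ℝ) : EReal)
      + ((2 * cTotal M π Θ * ((K : ℝ≥0∞) + 1) : ℝ≥0∞) : EReal) := by
  have hθ₀ : I.θ₀ ∈ Θ := by
    obtain ⟨o, ho⟩ := hθ_mem.exists
    have h := ho 0 K.zero_le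
    rwa [hθ] at h
  have hKL : 0 ≤ expectedKL M πstar (π I.θ₀) :=
    expectedKL_nonneg hπstar (hπ _ hθ₀) (hπ_pos _ hθ₀)
  by_cases hC : cTotal M π Θ = ⊤
  · rw [hC, ENNReal.mul_top two_ne_zero, ENNReal.top_mul (by simp), EReal.coe_ennreal_top,
      EReal.add_top_of_ne_bot]
    · exact le_top
    · exact EReal.add_ne_bot_iff.mpr ⟨EReal.coe_ennreal_ne_bot _, EReal.coe_ne_bot _⟩
  by_cases hε : epsBias M π Θ πstar = ⊤
  · by_cases hT0 : T = 0
    · rw [hT0]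
      simp only [Finset.range_zero, Finset.sum_empty, integral_zero, Nat.cast_zero, zero_mul,
        EReal.coe_zero, EReal.coe_ennreal_zero, zero_add]
      refine add_nonneg (EReal.coe_nonneg.mpr ?_) (EReal.coe_ennreal_nonneg _)
      -- Here `0 * ⊤ = 0` removes the bias term, so the remaining terms must be nonnegative by
      -- themselves: for `K = 0` only the KL term is left, otherwise the whole real part vanishes.
      have hzero : K = 0 ∨ I.H = 0 ∨ I.B = 0 := by
        rw [hT] at hT0
        simpa [or_assoc] using hT0
      rcases hzero with h | h | h
      · simp only [h, Finset.range_zero, Finset.sum_empty, mul_zero, zero_add]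
        positivity
      · simp [h]
      · simp [h]
    · rw [hε, ENNReal.mul_top two_ne_zero, ENNReal.top_rpow_of_pos (by norm_num),
        ENNReal.mul_top (by exact_mod_cast hT0), EReal.coe_ennreal_top, EReal.top_add_coe,
        EReal.top_add_of_ne_bot (EReal.coe_ennreal_ne_bot _)]
      exact le_top
  have hTK : T = K * (2 * I.H * I.B) := by rw [hT]; ring
  have h := hrun.integral_regret_le hΘ_open hΘ_convex hπ hπ_pos hπ_diff hunichain hG₁ hG₂ hμ
    hfisher hπstar hπstar_opt hα hθ hω hθ_mem hε hC
  have hbias : (T : ℝ≥0∞) * (2 * epsBias M π Θ πstar) ^ (1 / 2 : ℝ) =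
      ENNReal.ofReal (T * Real.sqrt (2 * (epsBias M π Θ πstar).toReal)) := by
    rw [ENNReal.ofReal_mul T.cast_nonneg, ENNReal.ofReal_natCast, Real.sqrt_eq_rpow,
      ← ENNReal.ofReal_rpow_of_nonneg (by positivity) (by norm_num),
      ENNReal.ofReal_mul zero_le_two, ENNReal.ofReal_toReal hε, ENNReal.ofReal_ofNat]
  have htot : 2 * cTotal M π Θ * ((K : ℝ≥0∞) + 1) =
      ENNReal.ofReal (2 * (cTotal M π Θ).toReal * (K + 1)) := by
    rw [ENNReal.ofReal_mul (by positivity), ENNReal.ofReal_mul zero_le_two,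
      ENNReal.ofReal_toReal hC, ENNReal.ofReal_ofNat, ENNReal.ofReal_add K.cast_nonneg zero_le_one,
      ENNReal.ofReal_natCast, ENNReal.ofReal_one]
  rw [hbias, htot, EReal.coe_ennreal_ofReal, EReal.coe_ennreal_ofReal,
    max_eq_left (by positivity), max_eq_left (by positivity), ← EReal.coe_add, ← EReal.coe_add,
    EReal.coe_le_coe_iff, hTK]
  refine h.trans ?_
  rw [Finset.sum_add_distrib, ← Finset.sum_div]
  push_cast
  -- The bound proved has `K` in place of `K + 1`; the difference of the two sides is exactly `2C`.
  refine sub_nonneg.mp (le_trans (b := 2 * (cTotal M π Θ).toReal) (by positivity) (le_of_eq ?_))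
  ring
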